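/- Let $k$ be a field and let $\mathcal P$ be a finite poset. A representation of $\mathcal P$ (a $k\mathcal P$-module) is a functor from $\mathcal P$ to $k$-vector spaces; $P_x$ and $I_x$ denote the indecomposable projective representation generated at $x$ and the indecomposable injective representation with socle at $x$, so that $P_x$ is $k$ on $\{y : x\le y\}$ and zero elsewhere and $I_x$ is $k$ on $\{y : y\le x\}$ and zero elsewhere. Let $a\le b$ in $\mathcal P$ be such that the interval $[a,b]$ is clamped in $\mathcal P$: whenever $a\le x$, either $x\le b$ or $b\le x$; and whenever $y\le b$, either $a\le y$ or $y\le a$. Write $\downarrow$ for restriction from $\mathcal P$ to $[a,b]$, and $\uparrow$ and $\Uparrow$ for induction $k\mathcal P\otimes_{k[a,b]}-$ and coinduction $\mathrm{Hom}_{k[a,b]}(k\mathcal P,-)$ from $[a,b]$ to $\mathcal P$. On derived categories $\uparrow$ and $\Uparrow$ denote the left derived functor of induction and the right derived functor of coinduction; there $\uparrow$ is left adjoint and $\Uparrow$ is right adjoint to $\downarrow$. $D^b$ denotes the derived category of complexes of representations with nonzero homology in only finitely many degrees. A complex has homology supported on $S$ if all its homology representations vanish at every element outside $S$. A minimal projective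 resolution of a complex is a quasi-isomorphism to it from a bounded above complex of projectives whose differentials have image in the radical; a minimal injective resolution is a quasi-isomorphism from it to a bounded below complex of injectives whose differentials vanish on the socle. Let $M$ and $N$ be complexes of $k\mathcal P$-modules with nonzero homology in only finitely many degrees, with the homology of $M$ supported on $[a,b)$ and the homology of $N$ supported on $(a,b]$. Then: 1. $M$ has a minimal projective resolution over $k\mathcal P$. For every minimal projective resolution $\Pi_M\to M$, each term of $\Pi_M$ is a direct sum of representations $P_x$ with $x\in[a,b]$ (with finite dimensional terms if the homology of $M$ is finite dimensional), and $\Pi_M$ is induced from $[a,b]$: it is isomorphic to the complex obtained by applying $\uparrow$ term by term to a bounded above complex of projective $k[a,b]$-modules. 2. The adjunction counit $M\!\downarrow\uparrow\;\to M$ is an isomorphism in $D^b(k\mathcal P)$, and $M\cong L\!\uparrow$ for some $L\in D^b(k[a,b])$. 3. $N$ has a minimal injective resolution over $k\mathcal P$. For every minimal injective resolution $N\to I_N$, each term of $I_N$ is a direct sum of representations $I_x$ with $x\in[a,b]$ (with finite dimensional terms if the homology of $N$ is finite dimensional), and $I_N$ is coinduced from $[a,b]$: it is isomorphic to the complex obtained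 by applying $\Uparrow$ term by term to a bounded below complex of injective $k[a,b]$-modules. 4. The adjunction unit $N\to N\!\downarrow\Uparrow$ is an isomorphism in $D^b(k\mathcal P)$, and $N\cong L\!\Uparrow$ for some $L\in D^b(k[a,b])$. 5. The functors $\uparrow$ and $\Uparrow$, restricted to the full subcategory of $D^b(k[a,b])$ of complexes with homology supported on the open interval $(a,b)$, are naturally isomorphic. -/

import Mathlib

open CategoryTheory Limits

universe w₁ w₂ u

/-- Representations over a field `k` of a poset `P`: functors from `P`, regarded as a category, to
the category of `k`-vector spaces (equivalently, modules over the incidence algebra `kP`). -/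
abbrev PosetRep (k : Type u) [Field k] (P : Type u) [PartialOrder P] : Type _ :=
  P ⥤ ModuleCat.{u} k

namespace PosetRep

section Basic

variable (k : Type u) [Field k] {P : Type u} [PartialOrder P]

/-- The closed interval `[a, b]` (with `a ≤ b`) is clamped in `P`: every `x ≥ a` satisfies `x ≤ b`
or `b ≤ x`, and every `y ≤ b` satisfies `a ≤ y` or `y ≤ a`. -/
class IsClamped (a b : P) : Prop where
  le : a ≤ b
  above : ∀ x, a ≤ x → x ≤ b ∨ b ≤ x
  below : ∀ y, y ≤ b → a ≤ y ∨ y ≤ a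

/-- The indecomposable projective `P_x`: the linearization of the representable functor at `x`.
It is `k` on `[x, ∞)` and zero elsewhere. -/
noncomputable def proj (x : P) : PosetRep k P where
  obj y := ModuleCat.of k ((x ⟶ y) →₀ k)
  map h := ModuleCat.ofHom (Finsupp.lmapDomain k k (fun g => g ≫ h))
  map_id y := by ext; simp
  map_comp f g := by ext; simp

/-- The indecomposable injective `I_x`: the `k`-dual of the linearized contravariant representable
functor at `x`. It is `k` on `(-∞, x]` and zero elsewhere. -/
def inj (x : P) : PosetRep k P where
  obj y := ModuleCat.of k ((y ⟶ x) → k)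
  map h := ModuleCat.ofHom (LinearMap.funLeft k k (fun g => h ≫ g))
  map_id y := by ext; simp
  map_comp f g := by ext; simp [LinearMap.funLeft_apply]

/-- The inclusion of a subposet, as a functor. -/
def inclusion (S : Set P) : S ⥤ P := Monotone.functor (f := fun x : S => (x : P)) fun _ _ h => h

/-- Restriction `↓` of representations of `P` to a subposet `S`. -/
def restriction (S : Set P) : PosetRep k P ⥤ PosetRep k S :=
  (Functor.whiskeringLeft S P (ModuleCat.{u} k)).obj (inclusion S)

/-- Induction `↑` from a subposet `S` to `P`: the functor `kP ⊗_{kS} -`, that is, the left Kan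
extension along the inclusion, with value `colim_{s ∈ S, s ≤ y} U(s)` at `y`. -/
noncomputable def induction (S : Set P) : PosetRep k S ⥤ PosetRep k P :=
  (inclusion S).lan

/-- Coinduction `⇑` from a subposet `S` to `P`: the functor `Hom_{kS}(kP, -)`, that is, the right
Kan extension along the inclusion, with value `lim_{s ∈ S, y ≤ s} U(s)` at `y`. -/
noncomputable def coinduction (S : Set P) : PosetRep k S ⥤ PosetRep k P :=
  (inclusion S).ran

/-- Induction is left adjoint to restriction. -/
noncomputable def inductionAdjunction (S : Set P) : induction k S ⊣ restriction k S :=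
  (inclusion S).lanAdjunction _

/-- Coinduction is right adjoint to restriction. -/
noncomputable def coinductionAdjunction (S : Set P) : restriction k S ⊣ coinduction k S :=
  (inclusion S).ranAdjunction _

instance restriction_additive (S : Set P) : (restriction k S).Additive where
  map_add := rfl

instance restriction_preservesFiniteLimits (S : Set P) :
    PreservesFiniteLimits (restriction k S) := by
  unfold restriction; exact ⟨fun _ _ _ => inferInstance⟩

instance restriction_preservesFiniteColimits (S : Set P) :
    PreservesFiniteColimits (restriction k S) := by
  unfold restriction; exact ⟨fun _ _ _ => inferInstance⟩

instance induction_additive (S : Set P) : (induction k S).Additive :=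
  (inductionAdjunction k S).left_adjoint_additive

instance coinduction_additive (S : Set P) : (coinduction k S).Additive :=
  (coinductionAdjunction k S).right_adjoint_additive

instance induction_preservesFiniteColimits (S : Set P) :
    PreservesFiniteColimits (induction k S) := by
  have := (inductionAdjunction k S).leftAdjoint_preservesColimits
  infer_instance

instance coinduction_preservesFiniteLimits (S : Set P) :
    PreservesFiniteLimits (coinduction k S) := by
  have := (coinductionAdjunction k S).rightAdjoint_preservesLimits
  infer_instance

end Basic

/-! ### Induction and coinduction from a clamped interval are exact -/

section Exact

variable {k : Type u} [Field k] {P : Type u} [PartialOrder P]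

/-- If the elements of `S` below `y` have a greatest element `t`, then an induced representation
takes at `y` the value of the original one at `t`. -/
lemma isIso_lanUnit_map {S : Set P} {y : P} {t : S} (f : (inclusion S).obj t ⟶ y)
    (ht : ∀ s : S, (s : P) ≤ y → s ≤ t) (W : PosetRep k S) :
    IsIso (((inclusion S).lanUnit.app W).app t ≫ ((inclusion S).lan.obj W).map f) := by
  have hT : IsTerminal (CostructuredArrow.mk f) := IsTerminal.ofUniqueHom
    (fun Z => CostructuredArrow.homMk (homOfLE (ht Z.left (leOfHom Z.hom)))
      (Subsingleton.elim _ _))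
    (fun Z m => by ext; exact Subsingleton.elim _ _)
  exact IsColimit.isIso_ι_app_of_isTerminal
    (Functor.isPointwiseLeftKanExtensionLeftKanExtensionUnit (inclusion S) W y) _ hT

lemma mono_lan_map_app (S : Set P) {U V : PosetRep k S} (f : U ⟶ V) [Mono f] (y : P)
    (hy : (∃ t : S, (t : P) ≤ y ∧ ∀ s : S, (s : P) ≤ y → s ≤ t) ∨ ∀ s : S, ¬ (s : P) ≤ y) :
    Mono (((inclusion S).lan.map f).app y) := by
  rcases hy with ⟨t, hty, ht⟩ | hy
  · let g : (inclusion S).obj t ⟶ y := homOfLE hty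
    have hU := isIso_lanUnit_map g ht U
    have hV := isIso_lanUnit_map g ht V
    have hf : Mono (f.app t) := (NatTrans.mono_iff_mono_app f).1 inferInstance t
    have comm : (((inclusion S).lanUnit.app U).app t ≫ ((inclusion S).lan.obj U).map g) ≫
        ((inclusion S).lan.map f).app y =
        f.app t ≫ ((inclusion S).lanUnit.app V).app t ≫ ((inclusion S).lan.obj V).map g := by
      have := congr_app ((inclusion S).lanUnit.naturality f) t
      dsimp at this
      rw [← Category.assoc (f.app t), this, Category.assoc, Category.assoc, NatTrans.naturality]
    have h2 : Mono ((((inclusion S).lanUnit.app U).app t ≫ ((inclusion S).lan.obj U).map g) ≫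
        ((inclusion S).lan.map f).app y) := by
      rw [comm]
      exact @mono_comp _ _ _ _ _ _ hf _ inferInstance
    rw [← IsIso.inv_hom_id_assoc (((inclusion S).lanUnit.app U).app t ≫
      ((inclusion S).lan.obj U).map g) (((inclusion S).lan.map f).app y)]
    infer_instance
  · have hE : IsEmpty (CostructuredArrow (inclusion S) y) := ⟨fun Z => hy Z.left (leOfHom Z.hom)⟩
    have h0 : IsZero (((inclusion S).lan.obj U).obj y) :=
      (IsZero.iff_id_eq_zero _).2
        ((Functor.isPointwiseLeftKanExtensionLeftKanExtensionUnit (inclusion S) U y).hom_ext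
          fun j => isEmptyElim j)
    exact ⟨fun _ _ _ => h0.eq_of_tgt _ _⟩

/-- If the elements of `S` above `y` have a least element `t`, then a coinduced representation
takes at `y` the value of the original one at `t`. -/
lemma isIso_map_ranCounit {S : Set P} {y : P} {t : S} (f : y ⟶ (inclusion S).obj t)
    (ht : ∀ s : S, y ≤ (s : P) → t ≤ s) (W : PosetRep k S) :
    IsIso (((inclusion S).ran.obj W).map f ≫ ((inclusion S).ranCounit.app W).app t) := by
  have hT : IsInitial (StructuredArrow.mk f) := IsInitial.ofUniqueHom
    (fun Z => StructuredArrow.homMk (homOfLE (ht Z.right (leOfHom Z.hom)))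
      (Subsingleton.elim _ _))
    (fun Z m => by ext; exact Subsingleton.elim _ _)
  exact IsLimit.isIso_π_app_of_isInitial
    (Functor.isPointwiseRightKanExtensionRanCounit (inclusion S) W y) _ hT

lemma epi_ran_map_app (S : Set P) {U V : PosetRep k S} (f : U ⟶ V) [Epi f] (y : P)
    (hy : (∃ t : S, y ≤ (t : P) ∧ ∀ s : S, y ≤ (s : P) → t ≤ s) ∨ ∀ s : S, ¬ y ≤ (s : P)) :
    Epi (((inclusion S).ran.map f).app y) := by
  rcases hy with ⟨t, hty, ht⟩ | hy
  · let g : y ⟶ (inclusion S).obj t := homOfLE hty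
    have hU := isIso_map_ranCounit g ht U
    have hV := isIso_map_ranCounit g ht V
    have hf : Epi (f.app t) := (NatTrans.epi_iff_epi_app f).1 inferInstance t
    have comm : ((inclusion S).ran.map f).app y ≫
        ((inclusion S).ran.obj V).map g ≫ ((inclusion S).ranCounit.app V).app t =
        (((inclusion S).ran.obj U).map g ≫ ((inclusion S).ranCounit.app U).app t) ≫ f.app t := by
      have := congr_app ((inclusion S).ranCounit.naturality f) t
      dsimp at this
      rw [Category.assoc, ← this, ← Category.assoc, ← Category.assoc, NatTrans.naturality]
    have h2 : Epi (((inclusion S).ran.map f).app y ≫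
        ((inclusion S).ran.obj V).map g ≫ ((inclusion S).ranCounit.app V).app t) := by
      rw [comm]
      exact @epi_comp _ _ _ _ _ _ (@IsIso.epi_of_iso _ _ _ _ _ hU) _ hf
    rw [← Category.comp_id (((inclusion S).ran.map f).app y), ← IsIso.hom_inv_id
      (((inclusion S).ran.obj V).map g ≫ ((inclusion S).ranCounit.app V).app t), ← Category.assoc]
    infer_instance
  · have hE : IsEmpty (StructuredArrow y (inclusion S)) := ⟨fun Z => hy Z.right (leOfHom Z.hom)⟩
    have h0 : IsZero (((inclusion S).ran.obj V).obj y) :=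
      (IsZero.iff_id_eq_zero _).2
        ((Functor.isPointwiseRightKanExtensionRanCounit (inclusion S) V y).hom_ext
          fun j => isEmptyElim j)
    exact ⟨fun _ _ _ => h0.eq_of_src _ _⟩

lemma clamped_induction_preservesMono (a b : P) [h : IsClamped a b] :
    (induction k (Set.Icc a b)).PreservesMonomorphisms where
  preserves f _ := by
    refine (NatTrans.mono_iff_mono_app _).2 fun y => mono_lan_map_app _ f y ?_
    by_cases hay : a ≤ y
    · left
      rcases h.above y hay with hyb | hby
      · exact ⟨⟨y, hay, hyb⟩, le_rfl, fun s hs => hs⟩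
      · exact ⟨⟨b, h.le, le_rfl⟩, hby, fun s _ => s.2.2⟩
    · exact Or.inr fun s hs => hay (s.2.1.trans hs)

lemma clamped_coinduction_preservesEpi (a b : P) [h : IsClamped a b] :
    (coinduction k (Set.Icc a b)).PreservesEpimorphisms where
  preserves f _ := by
    refine (NatTrans.epi_iff_epi_app _).2 fun y => epi_ran_map_app _ f y ?_
    by_cases hyb : y ≤ b
    · left
      rcases h.below y hyb with hay | hya
      · exact ⟨⟨y, hay, hyb⟩, le_rfl, fun s hs => hs⟩
      · exact ⟨⟨a, le_rfl, h.le⟩, hya, fun s _ => s.2.1⟩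
    · exact Or.inr fun s hs => hyb (hs.trans s.2.2)

instance clamped_induction_exact (a b : P) [IsClamped a b] :
    PreservesFiniteLimits (induction k (Set.Icc a b)) := by
  have := clamped_induction_preservesMono (k := k) a b
  refine (Functor.preservesFiniteLimits_iff_forall_exact_map_and_mono _).2 fun S hS => ⟨?_, ?_⟩
  · exact ((Functor.preservesFiniteColimits_iff_forall_exact_map_and_epi _).1 inferInstance S hS).1
  · have := hS.mono_f
    infer_instance

instance clamped_coinduction_exact (a b : P) [IsClamped a b] :
    PreservesFiniteColimits (coinduction k (Set.Icc a b)) := by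
  have := clamped_coinduction_preservesEpi (k := k) a b
  refine (Functor.preservesFiniteColimits_iff_forall_exact_map_and_epi _).2 fun S hS => ⟨?_, ?_⟩
  · exact ((Functor.preservesFiniteLimits_iff_forall_exact_map_and_mono _).1 inferInstance S hS).1
  · have := hS.epi_g
    infer_instance

end Exact

/-! ### Restriction, induction and coinduction on complexes and on derived categories -/

section Derived

/-- An adjunction between additive functors extends termwise to complexes. -/
noncomputable def complexAdjunction {A B : Type*} [Category* A] [Category* B]
    [Preadditive A] [Preadditive B] {F : A ⥤ B} {G : B ⥤ A} [F.Additive] [G.Additive]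
    (adj : F ⊣ G) : F.mapHomologicalComplex (ComplexShape.up ℤ) ⊣
      G.mapHomologicalComplex (ComplexShape.up ℤ) where
  unit :=
    { app := fun K =>
        { f := fun i => adj.unit.app (K.X i)
          comm' := fun i j _ => (adj.unit.naturality (K.d i j)).symm }
      naturality := fun _ _ f => by ext i; exact adj.unit.naturality (f.f i) }
  counit :=
    { app := fun K =>
        { f := fun i => adj.counit.app (K.X i)
          comm' := fun i j _ => (adj.counit.naturality (K.d i j)).symm }
      naturality := fun _ _ f => by ext i; exact adj.counit.naturality (f.f i) }
  left_triangle_components K := by ext i; exact adj.left_triangle_components (K.X i)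
  right_triangle_components K := by ext i; exact adj.right_triangle_components (K.X i)

variable (k : Type u) [Field k] {P : Type u} [PartialOrder P] (S : Set P)

/-- Restriction of complexes of representations, term by term. -/
noncomputable abbrev restrictionComplex :
    CochainComplex (PosetRep k P) ℤ ⥤ CochainComplex (PosetRep k S) ℤ :=
  (restriction k S).mapHomologicalComplex _

/-- Induction of complexes of representations, term by term. -/
noncomputable abbrev inductionComplex :
    CochainComplex (PosetRep k S) ℤ ⥤ CochainComplex (PosetRep k P) ℤ :=
  (induction k S).mapHomologicalComplex _

/-- Coinduction of complexes of representations, term by term. -/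
noncomputable abbrev coinductionComplex :
    CochainComplex (PosetRep k S) ℤ ⥤ CochainComplex (PosetRep k P) ℤ :=
  (coinduction k S).mapHomologicalComplex _

variable [HasDerivedCategory.{w₁} (PosetRep k P)] [HasDerivedCategory.{w₂} (PosetRep k S)]

/-- Restriction on derived categories (restriction is exact). -/
noncomputable def derivedRestriction :
    DerivedCategory (PosetRep k P) ⥤ DerivedCategory (PosetRep k S) :=
  (restriction k S).mapDerivedCategory

/-- Derived restriction is computed by restricting complexes term by term. -/
noncomputable def derivedRestrictionFactors :
    DerivedCategory.Q ⋙ derivedRestriction k S ≅ restrictionComplex k S ⋙ DerivedCategory.Q :=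
  (restriction k S).mapDerivedCategoryFactors

instance derivedRestriction_isRightDerived : (derivedRestriction k S).IsRightDerivedFunctor
    (derivedRestrictionFactors k S).inv (HomologicalComplex.quasiIso _ _) :=
  Functor.isRightDerivedFunctor_of_inverts _ _ _

instance derivedRestriction_isLeftDerived : (derivedRestriction k S).IsLeftDerivedFunctor
    (derivedRestrictionFactors k S).hom (HomologicalComplex.quasiIso _ _) :=
  Functor.isLeftDerivedFunctor_of_inverts _ _ _

instance induction_hasLeftDerived [PreservesFiniteLimits (induction k S)] :
    (inductionComplex k S ⋙ DerivedCategory.Q).HasLeftDerivedFunctor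
      (HomologicalComplex.quasiIso _ _) :=
  have := Functor.isLeftDerivedFunctor_of_inverts (HomologicalComplex.quasiIso _ _)
    _ (induction k S).mapDerivedCategoryFactors
  .mk' (LF := (induction k S).mapDerivedCategory)
    (α := (induction k S).mapDerivedCategoryFactors.hom)

instance coinduction_hasRightDerived [PreservesFiniteColimits (coinduction k S)] :
    (coinductionComplex k S ⋙ DerivedCategory.Q).HasRightDerivedFunctor
      (HomologicalComplex.quasiIso _ _) :=
  have := Functor.isRightDerivedFunctor_of_inverts (HomologicalComplex.quasiIso _ _)
    _ (coinduction k S).mapDerivedCategoryFactors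
  .mk' (RF := (coinduction k S).mapDerivedCategory)
    (α := (coinduction k S).mapDerivedCategoryFactors.inv)

/-- Derived induction `kP ⊗ᴸ_{kS} -`: the total left derived functor of induction. -/
noncomputable def derivedInduction
    [(inductionComplex k S ⋙ DerivedCategory.Q).HasLeftDerivedFunctor
      (HomologicalComplex.quasiIso _ _)] :
    DerivedCategory (PosetRep k S) ⥤ DerivedCategory (PosetRep k P) :=
  (inductionComplex k S ⋙ DerivedCategory.Q).totalLeftDerived DerivedCategory.Q
    (HomologicalComplex.quasiIso _ _)

/-- The canonical comparison from derived induction to termwise induction. -/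
noncomputable def derivedInductionCounit
    [(inductionComplex k S ⋙ DerivedCategory.Q).HasLeftDerivedFunctor
      (HomologicalComplex.quasiIso _ _)] :
    DerivedCategory.Q ⋙ derivedInduction k S ⟶ inductionComplex k S ⋙ DerivedCategory.Q :=
  (inductionComplex k S ⋙ DerivedCategory.Q).totalLeftDerivedCounit DerivedCategory.Q
    (HomologicalComplex.quasiIso _ _)

/-- Derived coinduction `RHom_{kS}(kP, -)`: the total right derived functor of coinduction. -/
noncomputable def derivedCoinduction
    [(coinductionComplex k S ⋙ DerivedCategory.Q).HasRightDerivedFunctor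
      (HomologicalComplex.quasiIso _ _)] :
    DerivedCategory (PosetRep k S) ⥤ DerivedCategory (PosetRep k P) :=
  (coinductionComplex k S ⋙ DerivedCategory.Q).totalRightDerived DerivedCategory.Q
    (HomologicalComplex.quasiIso _ _)

/-- The canonical comparison from termwise coinduction to derived coinduction. -/
noncomputable def derivedCoinductionUnit
    [(coinductionComplex k S ⋙ DerivedCategory.Q).HasRightDerivedFunctor
      (HomologicalComplex.quasiIso _ _)] :
    coinductionComplex k S ⋙ DerivedCategory.Q ⟶ DerivedCategory.Q ⋙ derivedCoinduction k S :=
  (coinductionComplex k S ⋙ DerivedCategory.Q).totalRightDerivedUnit DerivedCategory.Q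
    (HomologicalComplex.quasiIso _ _)

instance derivedInduction_isLeftDerived
    [(inductionComplex k S ⋙ DerivedCategory.Q).HasLeftDerivedFunctor
      (HomologicalComplex.quasiIso _ _)] :
    (derivedInduction k S).IsLeftDerivedFunctor (derivedInductionCounit k S)
      (HomologicalComplex.quasiIso _ _) := by
  unfold derivedInduction derivedInductionCounit; infer_instance

instance derivedCoinduction_isRightDerived
    [(coinductionComplex k S ⋙ DerivedCategory.Q).HasRightDerivedFunctor
      (HomologicalComplex.quasiIso _ _)] :
    (derivedCoinduction k S).IsRightDerivedFunctor (derivedCoinductionUnit k S)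
      (HomologicalComplex.quasiIso _ _) := by
  unfold derivedCoinduction derivedCoinductionUnit; infer_instance

instance derivedInductionCounit_isIso [PreservesFiniteLimits (induction k S)] :
    IsIso (derivedInductionCounit k S) := by
  have h := Functor.isLeftDerivedFunctor_of_inverts (HomologicalComplex.quasiIso _ _)
    _ (induction k S).mapDerivedCategoryFactors
  have e : derivedInductionCounit k S = Functor.whiskerLeft _ (Functor.leftDerivedUnique _ _
      (induction k S).mapDerivedCategoryFactors.hom (derivedInductionCounit k S)
      (HomologicalComplex.quasiIso _ _)).inv ≫
      (induction k S).mapDerivedCategoryFactors.hom := by simp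
  rw [e]
  infer_instance

instance derivedCoinductionUnit_isIso [PreservesFiniteColimits (coinduction k S)] :
    IsIso (derivedCoinductionUnit k S) := by
  have h := Functor.isRightDerivedFunctor_of_inverts (HomologicalComplex.quasiIso _ _)
    _ (coinduction k S).mapDerivedCategoryFactors
  have e : derivedCoinductionUnit k S =
      (coinduction k S).mapDerivedCategoryFactors.inv ≫
        Functor.whiskerLeft _ (Functor.rightDerivedUnique _ _
      (coinduction k S).mapDerivedCategoryFactors.inv (derivedCoinductionUnit k S)
      (HomologicalComplex.quasiIso _ _)).hom := by simp
  rw [e]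
  infer_instance

/-- The adjunction between derived induction and restriction, derived from the adjunction between
induction and restriction. -/
noncomputable def derivedInductionAdjunction [PreservesFiniteLimits (induction k S)] :
    derivedInduction k S ⊣ derivedRestriction k S :=
  have : (derivedInduction k S ⋙ derivedRestriction k S).IsLeftDerivedFunctor
      ((Functor.associator _ _ _).inv ≫
        Functor.whiskerRight (derivedInductionCounit k S) (derivedRestriction k S))
      (HomologicalComplex.quasiIso _ _) :=
    Functor.isLeftDerivedFunctor_of_inverts _ _ (asIso ((Functor.associator _ _ _).inv ≫
        Functor.whiskerRight (derivedInductionCounit k S) (derivedRestriction k S)))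
  have : (derivedRestriction k S ⋙ derivedInduction k S).IsRightDerivedFunctor
      (Functor.whiskerRight (derivedRestrictionFactors k S).inv (derivedInduction k S) ≫
        (Functor.associator _ _ _).hom)
      (HomologicalComplex.quasiIso _ _) :=
    Functor.isRightDerivedFunctor_of_inverts _ _ ((Functor.associator _ _ _).symm ≪≫
      Functor.isoWhiskerRight (derivedRestrictionFactors k S) (derivedInduction k S))
  (complexAdjunction (inductionAdjunction k S)).derived (HomologicalComplex.quasiIso _ _)
    (HomologicalComplex.quasiIso _ _) (derivedInductionCounit k S)
    (derivedRestrictionFactors k S).inv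

/-- The adjunction between restriction and derived coinduction, derived from the adjunction between
restriction and coinduction. -/
noncomputable def derivedCoinductionAdjunction [PreservesFiniteColimits (coinduction k S)] :
    derivedRestriction k S ⊣ derivedCoinduction k S :=
  have : (derivedRestriction k S ⋙ derivedCoinduction k S).IsLeftDerivedFunctor
      ((Functor.associator _ _ _).inv ≫
        Functor.whiskerRight (derivedRestrictionFactors k S).hom (derivedCoinduction k S))
      (HomologicalComplex.quasiIso _ _) :=
    Functor.isLeftDerivedFunctor_of_inverts _ _ ((Functor.associator _ _ _).symm ≪≫
      Functor.isoWhiskerRight (derivedRestrictionFactors k S) (derivedCoinduction k S))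
  have : (derivedCoinduction k S ⋙ derivedRestriction k S).IsRightDerivedFunctor
      (Functor.whiskerRight (derivedCoinductionUnit k S) (derivedRestriction k S) ≫
        (Functor.associator _ _ _).hom)
      (HomologicalComplex.quasiIso _ _) := by
    have := Functor.isRightDerivedFunctor_of_inverts (HomologicalComplex.quasiIso _ _)
      (derivedCoinduction k S ⋙ derivedRestriction k S)
      (asIso (Functor.whiskerRight (derivedCoinductionUnit k S) (derivedRestriction k S) ≫
        (Functor.associator _ _ _).hom)).symm
    exact this
  (complexAdjunction (coinductionAdjunction k S)).derived (HomologicalComplex.quasiIso _ _)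
    (HomologicalComplex.quasiIso _ _) (derivedRestrictionFactors k S).hom
    (derivedCoinductionUnit k S)

end Derived

/-! ### Homological support and minimal resolutions -/

section Resolutions

variable {k : Type u} [Field k] {P : Type u} [PartialOrder P]

/-- The homology of the complex `M` vanishes outside finitely many degrees. -/
def BoundedHomology (M : CochainComplex (PosetRep k P) ℤ) : Prop :=
  ∃ m n : ℤ, ∀ i : ℤ, i < m ∨ n < i → IsZero (M.homology i)

/-- The homology of the complex `M` is supported on `S`: it vanishes at each `x ∉ S`. -/
def HomologySupportedOn (S : Set P) (M : CochainComplex (PosetRep k P) ℤ) : Prop :=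
  ∀ (i : ℤ) (x : P), x ∉ S → IsZero ((M.homology i).obj x)

/-- The objects of the derived category of representations of `P` that have bounded homology,
supported on `S`. -/
def boundedSupportedOn (S : Set P) [HasDerivedCategory.{w₁} (PosetRep k P)] :
    ObjectProperty (DerivedCategory (PosetRep k P)) := fun M =>
  DerivedCategory.TStructure.t.bounded M ∧ ∀ (i : ℤ) (x : P), x ∉ S →
    IsZero (((DerivedCategory.homologyFunctor (PosetRep k P) i).obj M).obj x)

/-- The value at `y` of the radical `J V` of a representation `V`, where the Jacobson radical `J` of
`kP` is spanned by the strict relations `x < y`. -/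
def radical (V : PosetRep k P) (y : P) : Submodule k (V.obj y) :=
  ⨆ (x : P) (h : x < y), LinearMap.range (V.map (homOfLE h.le)).hom

/-- The value at `y` of the socle of a representation `V`: the vectors killed by the Jacobson
radical of `kP`, which is spanned by the strict relations `y < z`. -/
def socle (V : PosetRep k P) (y : P) : Submodule k (V.obj y) :=
  ⨅ (z : P) (h : y < z), LinearMap.ker (V.map (homOfLE h.le)).hom

/-- `π : R ⟶ M` is a minimal projective resolution of the complex `M`: a quasi-isomorphism from a
bounded above complex of projectives whose differentials have image in the radical. -/
structure IsMinimalProjectiveResolution {R M : CochainComplex (PosetRep k P) ℤ} (π : R ⟶ M) :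
    Prop where
  quasiIso : QuasiIso π
  boundedAbove : ∃ n : ℤ, ∀ i : ℤ, n < i → IsZero (R.X i)
  projective : ∀ i : ℤ, Projective (R.X i)
  minimal : ∀ (i j : ℤ) (y : P), LinearMap.range ((R.d i j).app y).hom ≤ radical (R.X j) y

/-- `ι : N ⟶ R` is a minimal injective resolution of the complex `N`: a quasi-isomorphism to a
bounded below complex of injectives whose differentials vanish on the socle. -/
structure IsMinimalInjectiveResolution {N R : CochainComplex (PosetRep k P) ℤ} (ι : N ⟶ R) :
    Prop where
  quasiIso : QuasiIso ι
  boundedBelow : ∃ n : ℤ, ∀ i : ℤ, i < n → IsZero (R.X i)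
  injective : ∀ i : ℤ, Injective (R.X i)
  minimal : ∀ (i j : ℤ) (y : P), socle (R.X i) y ≤ LinearMap.ker ((R.d i j).app y).hom

/-- `V` is a direct sum of representations `T x` with `x ∈ S` (repetitions are allowed). -/
def IsDirectSumFrom (T : P → PosetRep k P) (S : Set P) (V : PosetRep k P) : Prop :=
  ∃ (J : Type u) (x : J → P), (∀ j, x j ∈ S) ∧ Nonempty (V ≅ ∐ fun j => T (x j))

/-- `V` takes finite dimensional values. -/
def IsFiniteDimensional (V : PosetRep k P) : Prop :=
  ∀ x, FiniteDimensional k (V.obj x)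

end Resolutions

end PosetRep

/-! Clampedness says that the elements of `[a, b]` below a given `y` are absent or have a greatest
one, namely `y` itself or `b`. A representation induced from `[a, b]` therefore takes at `y` the
value zero or a value of the original one. So induction is exact, and `V` is induced as soon as it
vanishes off `[a, ∞)` and every transition `V b → V x` with `x ≥ b` is bijective
(`isIso_counit_app`). Dually, coinduction is exact, and `V` is coinduced if it vanishes off `(-∞,
b]` and every `V x → V a` with `x ≤ a` is bijective (`isIso_unit_app`).

The derived statements can be read off from homology. Exact functors commute with homology, so a
counit or unit is invertible on a complex if it is invertible on each homology representation
(`quasiIso_mapHomologicalComplex_app`). Homology supported on `[a, b)` vanishes off `[a, ∞)`, at `b`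
and above `b`, so the criterion holds with zero spaces on both sides. If the support is `(a, b)`,
the induced representation is still supported there, hence is coinduced as well, and the canonical
map from induction to coinduction is an isomorphism.

The terms of a minimal resolution need not have the support of the homology, and here minimality
does the work. Where `a ≤ x` fails, induction from below gives zero radicals, so zero differentials,
so terms equal to their homology, which is zero. Above `b`, transitions are injective because the
terms are projective. They are surjective by a chase that uses exactness at `b` and at `x`, with
boundaries lying in the radical (`bijective_of_minimal_projective`). Nakayama's lemma shows that a
projective is a sum of `P_x` with `x` occurring only where the radical is proper
(`exists_iso_freeOn`), which confines the summands to `[a, b]`. The injective case is dual, with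
socles for radicals.

Minimal resolutions are built by induction on an upper set carrying the homology
(`exists_minimal_projective_of_upperSet`): the homology at a minimal element is killed by a free
complex generated there, with zero differential, and the resolution of the cofiber is extended by
that complex. -/

namespace PosetRep

/-! ### Elementwise description of representations -/

section Elements

variable {k : Type u} [Field k] {P : Type u} [PartialOrder P]

/-- The transition map `V x → V y` of a representation, for `x ≤ y`. -/
abbrev tr (V : PosetRep k P) {x y : P} (h : x ≤ y) : V.obj x →ₗ[k] V.obj y :=
  (V.map (homOfLE h)).hom

/-- The value at `x` of a morphism of representations, as a linear map. -/
abbrev at' {V W : PosetRep k P} (f : V ⟶ W) (x : P) : V.obj x →ₗ[k] W.obj x := (f.app x).hom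

lemma tr_tr (V : PosetRep k P) {x y z : P} (h : x ≤ y) (h' : y ≤ z) (v : V.obj x) :
    tr V h' (tr V h v) = tr V (h.trans h') v := by
  have : V.map (homOfLE (h.trans h')) = V.map (homOfLE h) ≫ V.map (homOfLE h') := by
    rw [← V.map_comp]; rfl
  simp only [tr, this]; rfl

lemma tr_self (V : PosetRep k P) {x : P} (h : x ≤ x) (v : V.obj x) : tr V h v = v := by
  have : V.map (homOfLE h) = 𝟙 _ := V.map_id x
  simp only [tr, this]; rfl

lemma at_tr {V W : PosetRep k P} (f : V ⟶ W) {x y : P} (h : x ≤ y) (v : V.obj x) :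
    at' f y (tr V h v) = tr W h (at' f x v) := by
  have := f.naturality (homOfLE h)
  exact LinearMap.congr_fun (congrArg ModuleCat.Hom.hom this) v

lemma at_comp {U V W : PosetRep k P} (f : U ⟶ V) (g : V ⟶ W) (x : P) (v : U.obj x) :
    at' (f ≫ g) x v = at' g x (at' f x v) := rfl

lemma isIso_of_bijective {V W : PosetRep k P} (f : V ⟶ W)
    (h : ∀ x, Function.Bijective (at' f x)) : IsIso f := by
  have : ∀ x, IsIso (f.app x) := fun x =>
    (ConcreteCategory.isIso_iff_bijective (f.app x)).2 (h x)
  exact NatIso.isIso_of_isIso_app f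

lemma surjective_of_epi {V W : PosetRep k P} (f : V ⟶ W) [Epi f] (x : P) :
    Function.Surjective (at' f x) :=
  (ModuleCat.epi_iff_surjective _).1 ((NatTrans.epi_iff_epi_app f).1 inferInstance x)

lemma injective_of_mono {V W : PosetRep k P} (f : V ⟶ W) [Mono f] (x : P) :
    Function.Injective (at' f x) :=
  (ModuleCat.mono_iff_injective _).1 ((NatTrans.mono_iff_mono_app f).1 inferInstance x)

lemma epi_of_surjective {V W : PosetRep k P} (f : V ⟶ W)
    (h : ∀ x, Function.Surjective (at' f x)) : Epi f :=
  (NatTrans.epi_iff_epi_app f).2 fun x => (ModuleCat.epi_iff_surjective _).2 (h x)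

lemma mono_of_injective {V W : PosetRep k P} (f : V ⟶ W)
    (h : ∀ x, Function.Injective (at' f x)) : Mono f :=
  (NatTrans.mono_iff_mono_app f).2 fun x => (ModuleCat.mono_iff_injective _).2 (h x)

lemma tr_mem_radical (V : PosetRep k P) {x y : P} (h : x < y) (v : V.obj x) :
    tr V h.le v ∈ radical V y :=
  Submodule.mem_iSup_of_mem x (Submodule.mem_iSup_of_mem h ⟨v, rfl⟩)

lemma radical_le {V : PosetRep k P} {y : P} {U : Submodule k (V.obj y)}
    (h : ∀ (x : P) (hx : x < y) (v : V.obj x), tr V hx.le v ∈ U) : radical V y ≤ U :=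
  iSup₂_le fun x hx => by rintro _ ⟨v, rfl⟩; exact h x hx v

lemma mem_socle {V : PosetRep k P} {y : P} {v : V.obj y} :
    v ∈ socle V y ↔ ∀ (z : P) (hz : y < z), tr V hz.le v = 0 := by
  simp [socle, Submodule.mem_iInf]

lemma radical_le_comap {V W : PosetRep k P} (f : V ⟶ W) (y : P) :
    radical V y ≤ (radical W y).comap (at' f y) :=
  radical_le fun x hx v => by
    rw [Submodule.mem_comap, at_tr]; exact tr_mem_radical W hx _

/-- If `f` is surjective then so is the induced map on radicals. -/
lemma radical_le_map {V W : PosetRep k P} (f : V ⟶ W)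
    (hf : ∀ x, Function.Surjective (at' f x)) (y : P) :
    radical W y ≤ (radical V y).map (at' f y) :=
  radical_le fun x hx w => by
    obtain ⟨v, rfl⟩ := hf x w
    exact ⟨_, tr_mem_radical V hx v, at_tr f hx.le v⟩

/-- Nakayama's lemma: a subrepresentation that generates `V` modulo the radical is all of `V`. -/
lemma eq_top_of_sup_radical [WellFoundedLT P] {V : PosetRep k P} (U : ∀ y, Submodule k (V.obj y))
    (hU : ∀ (x y : P) (h : x ≤ y), ∀ v ∈ U x, tr V h v ∈ U y)
    (h : ∀ y, U y ⊔ radical V y = ⊤) (y : P) : U y = ⊤ := by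
  induction y using WellFoundedLT.induction with
  | ind y ih =>
    have : radical V y ≤ U y := radical_le fun x hx v => hU x y hx.le v (by simp [ih x hx])
    rw [← h y, sup_eq_left.2 this]

/-- Dual of Nakayama's lemma: a nonzero subrepresentation meets the socle. -/
lemma eq_bot_of_inf_socle [WellFoundedGT P] {V : PosetRep k P} (U : ∀ y, Submodule k (V.obj y))
    (hU : ∀ (x y : P) (h : x ≤ y), ∀ v ∈ U x, tr V h v ∈ U y)
    (h : ∀ y, U y ⊓ socle V y = ⊥) (y : P) : U y = ⊥ := by
  induction y using WellFoundedGT.induction with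
  | ind y ih =>
    have : U y ≤ socle V y := fun v hv => mem_socle.2 fun z hz => by
      simpa [ih z hz] using hU y z hz.le v hv
    rw [← h y, inf_eq_left.2 this]

/-- A representation with finite dimensional top is finite dimensional. -/
lemma finiteDimensional_of_radical [Finite P] {V : PosetRep k P}
    (h : ∀ y, ∃ U : Submodule k (V.obj y), FiniteDimensional k U ∧ U ⊔ radical V y = ⊤) :
    IsFiniteDimensional V := fun y => by
  induction y using WellFoundedLT.induction with
  | ind y ih =>
    obtain ⟨U, hU, h⟩ := h y
    have : FiniteDimensional k (radical V y) := by
      have : ∀ x, FiniteDimensional k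
          (⨆ h : x < y, LinearMap.range (V.map (homOfLE h.le)).hom : Submodule k _) := fun x => by
        by_cases hx : x < y
        · have := ih x hx
          rw [iSup_pos hx]
          infer_instance
        · rw [iSup_neg hx]
          infer_instance
      exact Submodule.finite_iSup _
    have : FiniteDimensional k (⊤ : Submodule k (V.obj y)) := by
      rw [← h]; infer_instance
    exact Module.finite_def.2 ((Submodule.fg_top _).1 (Module.finite_def.1 this))

/-- A representation with finite dimensional socle is finite dimensional. -/
lemma finiteDimensional_of_socle [Finite P] {V : PosetRep k P}
    (h : ∀ y, FiniteDimensional k (socle V y)) : IsFiniteDimensional V := fun y => by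
  induction y using WellFoundedGT.induction with
  | ind y ih =>
    let f : V.obj y →ₗ[k] ∀ z : {z // y < z}, V.obj z.1 := LinearMap.pi fun z => tr V z.2.le
    have hf : LinearMap.ker f = socle V y := by
      ext v
      simp [f, mem_socle, funext_iff]
    have : ∀ z : {z // y < z}, FiniteDimensional k (V.obj z.1) := fun z => ih z.1 z.2
    have h1 : FiniteDimensional k (LinearMap.ker f) := hf ▸ h y
    have h2 : FiniteDimensional k (LinearMap.range f) := inferInstance
    have : FiniteDimensional k (V.obj y ⧸ LinearMap.ker f) :=
      Module.Finite.equiv f.quotKerEquivRange.symm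
    exact Module.Finite.of_submodule_quotient (LinearMap.ker f)

end Elements

/-! ### Homology at an element of the poset -/

section Homology

variable {k : Type u} [Field k] {P : Type u} [PartialOrder P]

/-- The three terms of a complex around degree `j`, evaluated at `x`. -/
abbrev scAt (R : CochainComplex (PosetRep k P) ℤ) (i j l : ℤ) (x : P) :
    ShortComplex (ModuleCat.{u} k) :=
  (R.sc' i j l).map ((evaluation P (ModuleCat.{u} k)).obj x)

/-- The homology of a complex of representations at `x` is the homology of the complex at `x`. -/
noncomputable def homologyAtIso (R : CochainComplex (PosetRep k P) ℤ) {i j l : ℤ} (hij : i + 1 = j)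
    (hjl : j + 1 = l) (x : P) : (R.homology j).obj x ≅ (scAt R i j l x).homology :=
  ((evaluation P (ModuleCat.{u} k)).obj x).mapIso
      (ShortComplex.homologyMapIso (R.isoSc' i j l (by simp; omega) (by simp; omega))) ≪≫
    ((R.sc' i j l).mapHomologyIso ((evaluation P (ModuleCat.{u} k)).obj x)).symm

lemma exists_boundary (R : CochainComplex (PosetRep k P) ℤ) {i j l : ℤ} (hij : i + 1 = j)
    (hjl : j + 1 = l) {x : P} (h : IsZero ((R.homology j).obj x)) (v : (R.X j).obj x)
    (hv : at' (R.d j l) x v = 0) : ∃ u, at' (R.d i j) x u = v :=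
  (ShortComplex.moduleCat_exact_iff (scAt R i j l x)).1
    ((ShortComplex.exact_iff_isZero_homology _).2 (h.of_iso (homologyAtIso R hij hjl x).symm)) v hv

/-- Homology is cycles modulo boundaries, so any complement of the boundaries in the cycles is a
finite dimensional space of representatives. -/
lemma exists_finiteDimensional_sup_range (S : ShortComplex (ModuleCat.{u} k))
    (h : FiniteDimensional k S.homology) :
    ∃ U : Submodule k S.X₂, FiniteDimensional k U ∧
      U ⊔ LinearMap.range S.f.hom = LinearMap.ker S.g.hom := by
  have h1 : FiniteDimensional k
      (LinearMap.ker S.g.hom ⧸ LinearMap.range S.moduleCatToCycles) :=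
    Module.Finite.equiv S.moduleCatHomologyIso.toLinearEquiv
  obtain ⟨C, hC⟩ := Submodule.exists_isCompl (LinearMap.range S.moduleCatToCycles)
  have hfd : FiniteDimensional k C :=
    Module.Finite.equiv (Submodule.quotientEquivOfIsCompl _ _ hC)
  refine ⟨C.map (Submodule.subtype (LinearMap.ker S.g.hom)), inferInstance, ?_⟩
  have e : LinearMap.range S.f.hom =
      (LinearMap.range S.moduleCatToCycles).map (Submodule.subtype (LinearMap.ker S.g.hom)) := by
    rw [← LinearMap.range_comp]; rfl
  rw [e, ← Submodule.map_sup, sup_comm, hC.sup_eq_top, Submodule.map_top, Submodule.range_subtype]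

lemma exists_finiteDimensional_cycles (R : CochainComplex (PosetRep k P) ℤ) {i j l : ℤ}
    (hij : i + 1 = j) (hjl : j + 1 = l) {x : P}
    (h : FiniteDimensional k ((R.homology j).obj x)) :
    ∃ U : Submodule k ((R.X j).obj x), FiniteDimensional k U ∧
      U ⊔ LinearMap.range (at' (R.d i j) x) = LinearMap.ker (at' (R.d j l) x) :=
  exists_finiteDimensional_sup_range (scAt R i j l x)
    (Module.Finite.equiv (homologyAtIso R hij hjl x).toLinearEquiv)

lemma homology_obj_iso {R M : CochainComplex (PosetRep k P) ℤ} (π : R ⟶ M) [QuasiIso π] (i : ℤ)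
    (x : P) : Nonempty ((R.homology i).obj x ≅ (M.homology i).obj x) :=
  ⟨((evaluation P (ModuleCat.{u} k)).obj x).mapIso (isoOfQuasiIsoAt π i)⟩

lemma at_d_d (R : CochainComplex (PosetRep k P) ℤ) (i j l : ℤ) (x : P) (v : (R.X i).obj x) :
    at' (R.d j l) x (at' (R.d i j) x v) = 0 := by
  rw [← at_comp, R.d_comp_d]; rfl

end Homology

/-! ### The structure of projective representations -/

section Projective

variable (k : Type u) [Field k] {P : Type u} [PartialOrder P] {J : Type u}

/-- The direct sum of the projectives `P_{x j}`: at `y` it has a basis indexed by the `j` with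
`x j ≤ y`. -/
noncomputable def freeOn (x : J → P) : PosetRep k P where
  obj y := ModuleCat.of k ({j // x j ≤ y} →₀ k)
  map h := ModuleCat.ofHom (Finsupp.lmapDomain k k (fun j => ⟨j.1, j.2.trans (leOfHom h)⟩))
  map_id y := by ext; simp
  map_comp f g := by ext; simp

/-- The generators of `freeOn k x`. -/
noncomputable def freeOnGen (x : J → P) (j : J) : (freeOn k x).obj (x j) :=
  Finsupp.single (⟨j, le_rfl⟩ : {i // x i ≤ x j}) (1 : k)

variable {k}

/-- The morphism from `freeOn k x` with given values at the generators. -/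
noncomputable def freeOnDesc (x : J → P) {V : PosetRep k P} (v : ∀ j, V.obj (x j)) :
    freeOn k x ⟶ V where
  app y := ModuleCat.ofHom
    (Finsupp.linearCombination k (fun j : {j // x j ≤ y} => tr V j.2 (v j.1)))
  naturality y z h := by
    apply ModuleCat.hom_ext
    apply Finsupp.lhom_ext
    intro j c
    change Finsupp.linearCombination k _ (Finsupp.mapDomain _ (Finsupp.single j c)) =
      tr V (leOfHom h) (Finsupp.linearCombination k _ (Finsupp.single j c))
    rw [Finsupp.mapDomain_single, Finsupp.linearCombination_single,
      Finsupp.linearCombination_single, map_smul, tr_tr]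

lemma tr_freeOn_single (x : J → P) {y z : P} (h : y ≤ z) (j : {j // x j ≤ y}) (c : k) :
    tr (freeOn k x) h (Finsupp.single j c : {j // x j ≤ y} →₀ k) =
      (Finsupp.single (⟨j.1, j.2.trans h⟩ : {j // x j ≤ z}) c : _ →₀ k) :=
  Finsupp.mapDomain_single

lemma freeOn_single (x : J → P) {y : P} (j : {j // x j ≤ y}) (c : k) :
    (Finsupp.single j c : {j // x j ≤ y} →₀ k) =
      (c • tr (freeOn k x) j.2 (freeOnGen k x j.1) : (freeOn k x).obj y) := by
  rw [freeOnGen]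
  refine Eq.trans ?_ (congrArg (c • ·) (tr_freeOn_single x j.2 _ _).symm)
  exact (Finsupp.smul_single_one j c).symm

lemma freeOnDesc_single (x : J → P) {V : PosetRep k P} (v : ∀ j, V.obj (x j)) {y : P}
    (j : {j // x j ≤ y}) (c : k) :
    at' (freeOnDesc x v) y (Finsupp.single j c : {j // x j ≤ y} →₀ k) = c • tr V j.2 (v j.1) :=
  Finsupp.linearCombination_single ..

@[simp]
lemma freeOnDesc_gen (x : J → P) {V : PosetRep k P} (v : ∀ j, V.obj (x j)) (j : J) :
    at' (freeOnDesc x v) (x j) (freeOnGen k x j) = v j := by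
  rw [freeOnGen]
  exact (freeOnDesc_single ..).trans (by rw [one_smul, tr_self])

lemma freeOn_hom_ext (x : J → P) {V : PosetRep k P} {f g : freeOn k x ⟶ V}
    (h : ∀ j, at' f (x j) (freeOnGen k x j) = at' g (x j) (freeOnGen k x j)) : f = g := by
  ext y : 2
  apply ModuleCat.hom_ext
  apply Finsupp.lhom_ext
  intro j c
  change at' f y _ = at' g y _
  rw [freeOn_single, map_smul, map_smul, at_tr, at_tr, h]

/-- The generator of `P_x`. -/
noncomputable def projGen (x : P) : (proj k x).obj x := Finsupp.single (𝟙 x) (1 : k)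

/-- The morphism from `P_x` with given value at the generator. -/
noncomputable def projDesc {x : P} {V : PosetRep k P} (v : V.obj x) : proj k x ⟶ V where
  app y := ModuleCat.ofHom (Finsupp.linearCombination k (fun h : x ⟶ y => tr V (leOfHom h) v))
  naturality y z h := by
    apply ModuleCat.hom_ext
    apply Finsupp.lhom_ext
    intro j c
    change Finsupp.linearCombination k _ (Finsupp.mapDomain _ (Finsupp.single j c)) =
      tr V (leOfHom h) (Finsupp.linearCombination k _ (Finsupp.single j c))
    rw [Finsupp.mapDomain_single, Finsupp.linearCombination_single,
      Finsupp.linearCombination_single, map_smul, tr_tr]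

@[simp]
lemma projDesc_gen {x : P} {V : PosetRep k P} (v : V.obj x) :
    at' (projDesc v) x (projGen x) = v :=
  (Finsupp.linearCombination_single ..).trans (by rw [one_smul, tr_self])

lemma proj_hom_ext {x : P} {V : PosetRep k P} {f g : proj k x ⟶ V}
    (h : at' f x (projGen x) = at' g x (projGen x)) : f = g := by
  ext y : 2
  apply ModuleCat.hom_ext
  apply Finsupp.lhom_ext
  intro j c
  change at' f y _ = at' g y _
  have : (Finsupp.single j c : (x ⟶ y) →₀ k) =
      (c • tr (proj k x) (leOfHom j) (projGen x) : (proj k x).obj y) := by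
    rw [projGen]
    refine Eq.trans (Finsupp.smul_single_one j c).symm
      (congrArg (c • ·) ?_)
    exact (Finsupp.mapDomain_single (f := fun g : x ⟶ x => g ≫ homOfLE (leOfHom j))).symm
  rw [this, map_smul, map_smul, at_tr, at_tr, h]

/-- `freeOn k x` is the coproduct of the `P_{x j}`. -/
noncomputable def freeOnIso (x : J → P) : freeOn k x ≅ ∐ fun j => proj k (x j) where
  hom := freeOnDesc x fun j => at' (Sigma.ι (fun j => proj k (x j)) j) (x j) (projGen (x j))
  inv := Sigma.desc fun j => projDesc (freeOnGen k x j)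
  hom_inv_id := freeOn_hom_ext x fun j => by
    rw [at_comp, freeOnDesc_gen, ← at_comp, Sigma.ι_desc, projDesc_gen]; rfl
  inv_hom_id := by
    refine Sigma.hom_ext _ _ fun j => ?_
    rw [Sigma.ι_desc_assoc, Category.comp_id]
    apply proj_hom_ext
    rw [at_comp, projDesc_gen, freeOnDesc_gen]

lemma tr_freeOn_injective (x : J → P) {y z : P} (h : y ≤ z) :
    Function.Injective (tr (freeOn k x) h) :=
  Finsupp.mapDomain_injective fun _ _ hij => Subtype.ext (congrArg (fun a => a.1) hij)

/-- A projective representation is a direct sum of the `P_x`, where `x` occurs only if the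
representation is not equal to its radical at `x`. -/
theorem exists_iso_freeOn [Finite P] (V : PosetRep k P) [Projective V] :
    ∃ (J : Type u) (x : J → P), (∀ j, radical V (x j) ≠ ⊤) ∧ Nonempty (V ≅ freeOn k x) := by
  -- `C y` lifts the top of `V` at `y`. The free representation on bases of the `C y` is a
  -- projective cover of `V`.
  choose C hC using fun y => Submodule.exists_isCompl (radical V y)
  let B := fun y => Module.Basis.ofVectorSpace k (C y)
  let J := Σ y, Module.Basis.ofVectorSpaceIndex k (C y)
  let x : J → P := Sigma.fst
  let f : freeOn k x ⟶ V := freeOnDesc x fun j => (B j.1 j.2 : V.obj j.1)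
  let ι (y : P) (i : Module.Basis.ofVectorSpaceIndex k (C y)) : {j // x j ≤ y} := ⟨⟨y, i⟩, le_rfl⟩
  let m (y : P) : (Module.Basis.ofVectorSpaceIndex k (C y) →₀ k) →ₗ[k] (freeOn k x).obj y :=
    Finsupp.lmapDomain k k (ι y)
  have hfι (y) (c : Module.Basis.ofVectorSpaceIndex k (C y) →₀ k) :
      at' f y (m y c) = (B y).repr.symm c := by
    refine (Finsupp.linearCombination_mapDomain ..).trans ?_
    rw [Module.Basis.repr_symm_apply, Finsupp.linearCombination_apply,
      Finsupp.linearCombination_apply, Finsupp.sum, Finsupp.sum, Submodule.coe_sum]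
    refine Finset.sum_congr rfl fun i _ => ?_
    simp only [Function.comp, ι, tr_self]
    rfl
  -- Modulo the radical only the generators placed at `y` itself count: a basis vector coming from a
  -- generator at `z < y` is a transition image.
  have dec (y) (w : (freeOn k x).obj y) : ∃ c : Module.Basis.ofVectorSpaceIndex k (C y) →₀ k,
      w - m y c ∈ radical (freeOn k x) y := by
    have h0 (y) (a : (freeOn k x).obj y) (h : a ∈ radical (freeOn k x) y) :
        a - m y 0 ∈ radical (freeOn k x) y := by rwa [map_zero, sub_zero]
    have h1 (y) (a b : (freeOn k x).obj y) (h : b = a) : a - b ∈ radical (freeOn k x) y := by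
      rw [h, sub_self]; exact zero_mem _
    refine Finsupp.induction_linear (motive := fun w : (freeOn k x).obj y =>
      ∃ c, w - m y c ∈ radical (freeOn k x) y) w ⟨0, h0 y _ (zero_mem _)⟩ ?_ ?_
    · rintro v w ⟨c, hc⟩ ⟨d, hd⟩
      refine ⟨c + d, ?_⟩
      rw [map_add]
      convert add_mem hc hd using 1
      exact add_sub_add_comm (α := (freeOn k x).obj y) ..
    · rintro ⟨⟨z, i⟩, hz⟩ c
      rcases eq_or_lt_of_le (show z ≤ y from hz) with rfl | hz'
      · exact ⟨Finsupp.single i c, h1 z _ _ Finsupp.mapDomain_single⟩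
      · refine ⟨0, h0 y _ ?_⟩
        have h2 := tr_mem_radical (freeOn k x) hz'
          (Finsupp.single ⟨⟨z, i⟩, le_rfl⟩ c : {j // x j ≤ z} →₀ k)
        rw [tr_freeOn_single] at h2
        exact h2
  have hsurj : ∀ y, Function.Surjective (at' f y) := fun y => by
    rw [← LinearMap.range_eq_top]
    refine eq_top_of_sup_radical (fun y => LinearMap.range (at' f y)) ?_ (fun y => ?_) y
    · rintro x y h _ ⟨w, rfl⟩
      exact ⟨_, at_tr f h w⟩
    · rw [eq_top_iff, ← (hC y).sup_eq_top, sup_comm (radical V y)]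
      refine sup_le_sup_right (fun v hv => ?_) _
      exact ⟨_, (hfι y ((B y).repr ⟨v, hv⟩)).trans (by simp)⟩
  have := epi_of_surjective f hsurj
  let s : V ⟶ freeOn k x := Projective.factorThru (𝟙 V) f
  have hs : s ≫ f = 𝟙 V := Projective.factorThru_comp _ _
  have hs' (y) (v : V.obj y) : at' f y (at' s y v) = v := by rw [← at_comp, hs]; rfl
  -- `f` maps the span of the generators at `y` isomorphically onto `C y`, which is disjoint from
  -- the radical. A kernel vector therefore has no component along these generators.
  have hker (y) (w : (freeOn k x).obj y) (hw : at' f y w = 0) : w ∈ radical (freeOn k x) y := by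
    obtain ⟨c, hc⟩ := dec y w
    have h1 : at' f y (m y c) ∈ radical V y := by
      have := radical_le_comap f y hc
      rw [Submodule.mem_comap, map_sub, hw, zero_sub] at this
      exact neg_mem_iff.1 this
    have h2 : at' f y (m y c) ∈ C y := by
      rw [hfι]; exact Subtype.property _
    have h3 : ((B y).repr.symm c : V.obj y) = 0 := by
      rw [← hfι]; exact (Submodule.disjoint_def.1 (hC y).disjoint) _ h1 h2
    have h4 : c = 0 := (B y).repr.symm.map_eq_zero_iff.1 (Subtype.ext h3)
    rwa [h4, map_zero, sub_zero] at hc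
  -- Each `w` differs from `s (f w)` by a kernel vector, so the image of `s` generates modulo the
  -- radical and Nakayama's lemma applies again.
  have hssurj : ∀ y, Function.Surjective (at' s y) := fun y => by
    rw [← LinearMap.range_eq_top]
    refine eq_top_of_sup_radical (fun y => LinearMap.range (at' s y)) ?_ (fun y => ?_) y
    · rintro x y h _ ⟨w, rfl⟩
      exact ⟨_, at_tr s h w⟩
    · refine eq_top_iff.2 fun w _ => ?_
      rw [← add_sub_cancel (at' s y (at' f y w)) w]
      exact Submodule.add_mem_sup ⟨_, rfl⟩ (hker y _ (by rw [map_sub, hs', sub_self]))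
  have : IsIso s := isIso_of_bijective s fun y =>
    ⟨Function.LeftInverse.injective (hs' y), hssurj y⟩
  refine ⟨J, x, fun j hj => ?_, ⟨asIso s⟩⟩
  have h1 : C j.1 = ⊥ := (hC j.1).inf_eq_bot ▸ (by
    change radical V j.1 = ⊤ at hj
    rw [hj, top_inf_eq])
  have h2 := (B j.1).ne_zero j.2
  have h3 : ((B j.1 j.2 : C j.1) : V.obj j.1) ∈ (⊥ : Submodule k (V.obj j.1)) :=
    h1 ▸ (B j.1 j.2).2
  exact h2 (Subtype.ext ((Submodule.mem_bot k).1 h3))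

/-- In a sum of `P_x`, going up only adds basis vectors. This allows a cycle condition at `x ≥ b` to
be pulled back to `b`. -/
lemma tr_injective_of_projective [Finite P] (V : PosetRep k P) [Projective V] {y z : P}
    (h : y ≤ z) : Function.Injective (tr V h) := by
  obtain ⟨J, x, -, ⟨e⟩⟩ := exists_iso_freeOn V
  refine Function.Injective.of_comp (f := at' e.hom z) ?_
  have : at' e.hom z ∘ tr V h = tr (freeOn k x) h ∘ at' e.hom y := funext fun v => at_tr e.hom h v
  rw [this]
  exact (tr_freeOn_injective x h).comp (injective_of_mono e.hom y)

lemma isDirectSumFrom_proj [Finite P] (V : PosetRep k P) [Projective V] {S : Set P}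
    (hS : ∀ y ∉ S, radical V y = ⊤) : IsDirectSumFrom (proj k) S V := by
  obtain ⟨J, x, hx, ⟨e⟩⟩ := exists_iso_freeOn V
  exact ⟨J, x, fun j => by_contra fun h => hx j (hS _ h), ⟨e ≪≫ freeOnIso x⟩⟩

end Projective

/-! ### The structure of injective representations -/

section Injective

variable (k : Type u) [Field k] {P : Type u} [PartialOrder P] {J : Type u}

lemma inclusion_le_injective (x : J → P) {y z : P} (h : y ≤ z) : Function.Injective
    (fun j : {j // z ≤ x j} => (⟨j.1, h.trans j.2⟩ : {j // y ≤ x j})) :=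
  fun _ _ hij => Subtype.ext (congrArg (fun a => a.1) hij)

/-- The direct sum of the injectives `I_{x j}`: at `y` it has a basis indexed by the `j` with
`y ≤ x j`. -/
noncomputable def cofreeOn (x : J → P) : PosetRep k P where
  obj y := ModuleCat.of k ({j // y ≤ x j} →₀ k)
  map h := ModuleCat.ofHom (Finsupp.lcomapDomain (fun j => ⟨j.1, (leOfHom h).trans j.2⟩)
    (inclusion_le_injective x (leOfHom h)))
  map_id y := by
    apply ModuleCat.hom_ext
    apply LinearMap.ext
    intro w
    apply Finsupp.ext
    intro j
    rfl
  map_comp f g := by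
    apply ModuleCat.hom_ext
    apply LinearMap.ext
    intro w
    apply Finsupp.ext
    intro j
    rfl

variable {k}

/-- The coordinates of an element of `cofreeOn k x`. -/
abbrev coord (x : J → P) {y : P} (w : (cofreeOn k x).obj y) : {j // y ≤ x j} →₀ k := w

lemma tr_cofreeOn_surjective (x : J → P) {y z : P} (h : y ≤ z) :
    Function.Surjective (tr (cofreeOn k x) h) := fun w =>
  ⟨(Finsupp.mapDomain (fun j => ⟨j.1, h.trans j.2⟩) (coord x w) : {j // y ≤ x j} →₀ k), by
    apply Finsupp.ext
    intro j
    exact Finsupp.mapDomain_apply (inclusion_le_injective x h) (coord x w) j⟩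

open Classical in
/-- The inclusion of a summand in `cofreeOn k x`, at `y`. -/
noncomputable def cofreeOnιAt (x : J → P) (j : J) (y : P) :
    ((y ⟶ x j) → k) →ₗ[k] {j // y ≤ x j} →₀ k where
  toFun f := Finsupp.ofSupportFinite
    (fun i => if h : i.1 = j then f (homOfLE (h ▸ i.2)) else 0)
    (Set.Subsingleton.finite fun a ha b hb => by
      have h1 : a.1 = j := by by_contra h; simp [h] at ha
      have h2 : b.1 = j := by by_contra h; simp [h] at hb
      exact Subtype.ext (h1.trans h2.symm))
  map_add' f g := Finsupp.ext fun i => by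
    simp only [Finsupp.ofSupportFinite_coe, Finsupp.add_apply]
    split_ifs <;> simp
  map_smul' c f := Finsupp.ext fun i => by
    simp only [Finsupp.ofSupportFinite_coe, Finsupp.smul_apply]
    split_ifs <;> simp

/-- The inclusion of a summand in `cofreeOn k x`. -/
noncomputable def cofreeOnι (x : J → P) (j : J) : inj k (x j) ⟶ cofreeOn k x where
  app y := ModuleCat.ofHom (cofreeOnιAt x j y)
  naturality y z h := by
    apply ModuleCat.hom_ext
    apply LinearMap.ext
    intro f
    apply Finsupp.ext
    intro i
    rfl

/-- The element of `I_x` at `y ≤ x` with given value. -/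
def injConst (x y : P) : k →ₗ[k] (inj k x).obj y := LinearMap.pi fun _ => LinearMap.id

lemma tr_injConst (x : P) {y z : P} (h : y ≤ z) (c : k) :
    tr (inj k x) h (injConst x y c) = injConst x z c := rfl

lemma injConst_eq_zero {x y : P} (h : ¬ y ≤ x) (c : k) : injConst x y c = 0 :=
  funext fun g => (h (leOfHom g)).elim

lemma eq_injConst {x y : P} (h : y ≤ x) (f : (inj k x).obj y) :
    f = injConst x y ((f : (y ⟶ x) → k) (homOfLE h)) := rfl

lemma cofreeOnι_injConst (x : J → P) {j : J} {y : P} (h : y ≤ x j) (c : k) :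
    at' (cofreeOnι x j) y (injConst (x j) y c) =
      (Finsupp.single (⟨j, h⟩ : {j // y ≤ x j}) c : _ →₀ k) := by
  classical
  apply Finsupp.ext
  intro i
  rw [Finsupp.single_apply]
  change dite (i.1 = j) (fun _ => c) (fun _ => 0) = _
  simp only [Subtype.ext_iff, eq_comm, dite_eq_ite]

/-- The morphism from `cofreeOn k x` with given restrictions to the summands. -/
noncomputable def cofreeOnDesc (x : J → P) {V : PosetRep k P} (f : ∀ j, inj k (x j) ⟶ V) :
    cofreeOn k x ⟶ V where
  app y := ModuleCat.ofHom
    (Finsupp.lsum k fun j : {j // y ≤ x j} => at' (f j.1) y ∘ₗ injConst (x j.1) y)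
  naturality y z h := by
    apply ModuleCat.hom_ext
    apply Finsupp.lhom_ext
    intro j c
    change Finsupp.lsum k _ (Finsupp.comapDomain _ (Finsupp.single j c) _) =
      tr V (leOfHom h) (Finsupp.lsum k _ (Finsupp.single j c))
    rw [Finsupp.lsum_single, LinearMap.comp_apply, ← at_tr, tr_injConst]
    by_cases hz : z ≤ x j.1
    · have : Finsupp.comapDomain _ (Finsupp.single j c)
          (inclusion_le_injective x (leOfHom h)).injOn =
          Finsupp.single (⟨j.1, hz⟩ : {j // z ≤ x j}) c := by
        classical
        ext i
        simp only [Finsupp.comapDomain_apply, Finsupp.single_apply, Subtype.ext_iff]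
      rw [this, Finsupp.lsum_single]
      rfl
    · have : Finsupp.comapDomain _ (Finsupp.single j c)
          (inclusion_le_injective x (leOfHom h)).injOn = 0 := by
        ext i
        rw [Finsupp.comapDomain_apply, Finsupp.coe_zero, Pi.zero_apply]
        refine Finsupp.single_eq_of_ne fun e => hz ?_
        rw [← e]
        exact i.2
      rw [this, injConst_eq_zero hz, map_zero, map_zero]

lemma cofreeOnDesc_single (x : J → P) {V : PosetRep k P} (f : ∀ j, inj k (x j) ⟶ V) {y : P}
    (j : {j // y ≤ x j}) (c : k) :
    at' (cofreeOnDesc x f) y (Finsupp.single j c : {j // y ≤ x j} →₀ k) =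
      at' (f j.1) y (injConst (x j.1) y c) :=
  Finsupp.lsum_single ..

/-- `cofreeOn k x` is the coproduct of the `I_{x j}`. -/
noncomputable def cofreeOnIso (x : J → P) : cofreeOn k x ≅ ∐ fun j => inj k (x j) where
  hom := cofreeOnDesc x fun j => Sigma.ι (fun j => inj k (x j)) j
  inv := Sigma.desc fun j => cofreeOnι x j
  hom_inv_id := by
    ext y : 2
    apply ModuleCat.hom_ext
    apply Finsupp.lhom_ext
    intro j c
    change at' (Sigma.desc _) y (at' _ y _) = _
    rw [cofreeOnDesc_single, ← at_comp, Sigma.ι_desc, cofreeOnι_injConst x j.2]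
    rfl
  inv_hom_id := by
    refine Sigma.hom_ext _ _ fun j => ?_
    rw [Sigma.ι_desc_assoc, Category.comp_id]
    ext y : 2
    apply ModuleCat.hom_ext
    apply LinearMap.ext
    intro f
    change at' (cofreeOnDesc x fun j => Sigma.ι (fun j => inj k (x j)) j) y
      (at' (cofreeOnι x j) y f) = at' (Sigma.ι (fun j => inj k (x j)) j) y f
    by_cases hy : y ≤ x j
    · rw [eq_injConst hy f, cofreeOnι_injConst x hy, cofreeOnDesc_single]
    · have : f = 0 := funext fun g => (hy (leOfHom g)).elim
      rw [this, map_zero, map_zero, map_zero]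

/-- An injective representation is a direct sum of the `I_x`, where `x` occurs only if the socle
of the representation does not vanish at `x`. -/
theorem exists_iso_cofreeOn [Finite P] (V : PosetRep k P) [Injective V] :
    ∃ (J : Type u) (x : J → P), (∀ j, socle V (x j) ≠ ⊥) ∧ Nonempty (V ≅ cofreeOn k x) := by
  choose ρ hρ using fun y => (socle V y).subtype.exists_leftInverse_of_injective
    (LinearMap.ker_eq_bot.2 (Submodule.subtype_injective _))
  replace hρ (y) (s : socle V y) : ρ y s = s := LinearMap.congr_fun (hρ y) s
  let B := fun y => Module.Basis.ofVectorSpace k (socle V y)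
  let J := Σ y, Module.Basis.ofVectorSpaceIndex k (socle V y)
  let x : J → P := Sigma.fst
  -- The coordinate at `j`: push `v` up to `x j`, retract onto the socle there, read off a basis
  -- coefficient. This is natural in `y` although the `ρ` are arbitrary, since `ρ` is only evaluated
  -- at `x j`.
  let c (y : P) (v : V.obj y) (j : {j // y ≤ x j}) : k :=
    (B j.1.1).repr (ρ j.1.1 (tr V j.2 v)) j.1.2
  -- Over each `z` finitely many coefficients are nonzero, and `P` is finite. This is why a direct
  -- sum, and not only a product, receives the map.
  have hc (y v) : (Function.support (c y v)).Finite := by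
    have h1 : ∀ z, Set.Finite {j : {j // y ≤ x j} | j.1.1 = z ∧ c y v j ≠ 0} := fun z => by
      by_cases hz : y ≤ z
      · refine ((((B z).repr (ρ z (tr V hz v))).support.finite_toSet).image
          (fun i => (⟨⟨z, i⟩, hz⟩ : {j // y ≤ x j}))).subset ?_
        rintro ⟨⟨z', i⟩, h⟩ ⟨rfl, h'⟩
        exact ⟨i, by simpa [c] using h', rfl⟩
      · refine Set.finite_empty.subset ?_
        rintro ⟨⟨z', i⟩, h⟩ ⟨rfl, h'⟩
        exact hz h
    refine (Set.finite_iUnion h1).subset fun j hj => Set.mem_iUnion.2 ⟨_, rfl, hj⟩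
  let e : V ⟶ cofreeOn k x :=
    { app := fun y => ModuleCat.ofHom (Y := ((cofreeOn k x).obj y : Type u))
        { toFun := fun v => (Finsupp.ofSupportFinite (c y v) (hc y v) : {j // y ≤ x j} →₀ k)
          map_add' := fun v w => Finsupp.ext fun j => by
            change c y (v + w) j = c y v j + c y w j
            simp only [c, map_add, Finsupp.add_apply]
          map_smul' := fun a v => Finsupp.ext fun j => by
            change c y (a • v) j = a * c y v j
            simp only [c, map_smul, Finsupp.smul_apply, smul_eq_mul] }
      naturality := fun y z h => by
        apply ModuleCat.hom_ext
        apply LinearMap.ext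
        intro v
        apply Finsupp.ext
        intro j
        change c z (tr V (leOfHom h) v) j = c y v ⟨j.1, (leOfHom h).trans j.2⟩
        simp only [c, tr_tr] }
  have he (y) (v : V.obj y) (j) : coord x (at' e y v) j = c y v j := rfl
  have hinj : ∀ y, Function.Injective (at' e y) := fun y => by
    rw [← LinearMap.ker_eq_bot]
    refine eq_bot_of_inf_socle (fun y => LinearMap.ker (at' e y)) ?_ (fun y => ?_) y
    · intro y z h v hv
      rw [LinearMap.mem_ker] at hv ⊢
      rw [at_tr, hv, map_zero]
    · refine eq_bot_iff.2 fun v hv => ?_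
      obtain ⟨hv, hv'⟩ := Submodule.mem_inf.1 hv
      have h1 : (B y).repr ⟨v, hv'⟩ = 0 := Finsupp.ext fun i => by
        have h2 := he y v ⟨⟨y, i⟩, le_rfl⟩
        rw [LinearMap.mem_ker.1 hv] at h2
        simp only [c, tr_self] at h2
        rw [← hρ y ⟨v, hv'⟩]
        exact h2.symm
      have h3 : (⟨v, hv'⟩ : socle V y) = 0 := (B y).repr.map_eq_zero_iff.1 h1
      exact (Submodule.mem_bot k).2 (congrArg Subtype.val h3)
  have := mono_of_injective e hinj
  let r : cofreeOn k x ⟶ V := Injective.factorThru (𝟙 V) e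
  have hr : e ≫ r = 𝟙 V := Injective.comp_factorThru _ _
  have hr' (y) (v : V.obj y) : at' r y (at' e y v) = v := by rw [← at_comp, hr]; rfl
  have hrinj : ∀ y, Function.Injective (at' r y) := fun y => by
    rw [← LinearMap.ker_eq_bot]
    refine eq_bot_of_inf_socle (fun y => LinearMap.ker (at' r y)) ?_ (fun y => ?_) y
    · intro y z h v hv
      rw [LinearMap.mem_ker] at hv ⊢
      rw [at_tr, hv, map_zero]
    -- A socle vector `w` has no coordinates over any `z > y`, so it equals `e s` for the socle
    -- vector `s` of `V` with the same coordinates over `y`. Then `s = r (e s) = r w = 0`.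
    · refine eq_bot_iff.2 fun w hw => ?_
      obtain ⟨hw, hw'⟩ := Submodule.mem_inf.1 hw
      let d : Module.Basis.ofVectorSpaceIndex k (socle V y) →₀ k :=
        Finsupp.comapDomain (fun i => (⟨⟨y, i⟩, le_rfl⟩ : {j // y ≤ x j})) (coord x w)
          (fun i _ i' _ h => by
            have h' := congrArg Subtype.val h
            exact eq_of_heq (Sigma.mk.inj h').2)
      let s : socle V y := (B y).repr.symm d
      have h1 : at' e y s.1 = w := Finsupp.ext fun j => by
        refine (he y s.1 j).trans ?_
        obtain ⟨⟨z, i⟩, hz⟩ := j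
        rcases eq_or_lt_of_le (show y ≤ z from hz) with rfl | hz'
        · simp only [c, tr_self, hρ, s, LinearEquiv.apply_symm_apply]
          rfl
        · have h2 := congrArg (fun a => coord x a ⟨⟨z, i⟩, le_rfl⟩) (mem_socle.1 hw' z hz')
          have h3 := mem_socle.1 s.2 z hz'
          simp only [c]
          rw [h3, map_zero, map_zero]
          exact h2.symm
      have h2 : s.1 = 0 := by rw [← hr' y s.1, h1]; exact hw
      rw [Submodule.mem_bot, ← h1, h2, map_zero]
  have : IsIso r := isIso_of_bijective r fun y =>
    ⟨hrinj y, Function.RightInverse.surjective (hr' y)⟩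
  refine ⟨J, x, fun j hj => ?_, ⟨(asIso r).symm⟩⟩
  have h2 := (B j.1).ne_zero j.2
  have h3 : ((B j.1 j.2 : socle V j.1) : V.obj j.1) ∈ (⊥ : Submodule k (V.obj j.1)) :=
    hj ▸ (B j.1 j.2).2
  exact h2 (Subtype.ext ((Submodule.mem_bot k).1 h3))

/-- In a sum of `I_x`, coordinates at `z` extend by zero to coordinates at `y ≤ z`. This allows
vectors at `a` to be lifted to `x ≤ a`. -/
lemma tr_surjective_of_injective [Finite P] (V : PosetRep k P) [Injective V] {y z : P}
    (h : y ≤ z) : Function.Surjective (tr V h) := by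
  obtain ⟨J, x, -, ⟨e⟩⟩ := exists_iso_cofreeOn V
  refine Function.Surjective.of_comp (g := at' e.inv y) ?_
  have : tr V h ∘ at' e.inv y = at' e.inv z ∘ tr (cofreeOn k x) h :=
    funext fun v => (at_tr e.inv h v).symm
  rw [this]
  exact (surjective_of_epi e.inv z).comp (tr_cofreeOn_surjective x h)

lemma isDirectSumFrom_inj [Finite P] (V : PosetRep k P) [Injective V] {S : Set P}
    (hS : ∀ y ∉ S, socle V y = ⊥) : IsDirectSumFrom (inj k) S V := by
  obtain ⟨J, x, hx, ⟨e⟩⟩ := exists_iso_cofreeOn V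
  exact ⟨J, x, fun j => by_contra fun h => hx j (hS _ h), ⟨e ≪≫ cofreeOnIso x⟩⟩

end Injective

/-! ### Recognizing induced and coinduced representations. -/

section Counit

variable {k : Type u} [Field k] {P : Type u} [PartialOrder P]

/-- Here `e1` will be a naturality square of a counit and `e2` a triangle identity, so that the
counit component `h` differs from a transition `m` by an isomorphism. -/
lemma isIso_of_comm_left {C : Type*} [Category* C] {X Y Z W : C} {f : X ⟶ Y} {g : Y ⟶ Z}
    {h : Z ⟶ W} {h' : Y ⟶ X} {m : X ⟶ W} (hfg : IsIso (f ≫ g)) (hm : IsIso m)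
    (e1 : g ≫ h = h' ≫ m) (e2 : f ≫ h' = 𝟙 X) : IsIso h := by
  have : (f ≫ g) ≫ h = m := by rw [Category.assoc, e1, reassoc_of% e2]
  exact IsIso.of_isIso_fac_left this

lemma isIso_of_comm_right {C : Type*} [Category* C] {X Y Z W : C} {f : Z ⟶ Y} {g : Y ⟶ X}
    {h : W ⟶ Z} {h' : X ⟶ Y} {m : W ⟶ X} (hfg : IsIso (f ≫ g)) (hm : IsIso m)
    (e1 : m ≫ h' = h ≫ f) (e2 : h' ≫ g = 𝟙 X) : IsIso h := by
  have : h ≫ (f ≫ g) = m := by rw [← Category.assoc, ← e1, Category.assoc, e2, Category.comp_id]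
  exact IsIso.of_isIso_fac_right this

/-- The source of the counit at `x` is `V t` or an empty colimit. In the first case naturality along
`t ≤ x` and a triangle identity turn the counit into the transition `V t → V x`. -/
lemma isIso_counit_app_app {S : Set P} (V : PosetRep k P) (x : P)
    (h : (∃ (t : S) (ht : (t : P) ≤ x), (∀ s : S, (s : P) ≤ x → s ≤ t) ∧
        Function.Bijective (tr V ht)) ∨
      ((∀ s : S, ¬ (s : P) ≤ x) ∧ Subsingleton (V.obj x))) :
    IsIso (((inductionAdjunction k S).counit.app V).app x) := by
  rcases h with ⟨t, htx, ht, hV⟩ | ⟨hx, hV⟩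
  · let f : (inclusion S).obj t ⟶ x := homOfLE htx
    have h1 := isIso_lanUnit_map f ht ((restriction k S).obj V)
    have h2 : IsIso (V.map f) := (ConcreteCategory.isIso_iff_bijective _).2 hV
    exact isIso_of_comm_left h1 h2 (((inductionAdjunction k S).counit.app V).naturality f)
      (congr_app ((inductionAdjunction k S).right_triangle_components V) t)
  · have hE : IsEmpty (CostructuredArrow (inclusion S) x) := ⟨fun Z => hx Z.left (leOfHom Z.hom)⟩
    have h0 : IsZero (((inclusion S).lan.obj ((restriction k S).obj V)).obj x) :=
      (IsZero.iff_id_eq_zero _).2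
        ((Functor.isPointwiseLeftKanExtensionLeftKanExtensionUnit (inclusion S) _ x).hom_ext
          fun j => isEmptyElim j)
    exact h0.isIso (ModuleCat.isZero_of_subsingleton (V.obj x)) _

/-- The target of the unit at `x` is `V t` or an empty limit. In the first case the unit becomes the
transition `V x → V t`. -/
lemma isIso_unit_app_app {S : Set P} (V : PosetRep k P) (x : P)
    (h : (∃ (t : S) (ht : x ≤ (t : P)), (∀ s : S, x ≤ (s : P) → t ≤ s) ∧
        Function.Bijective (tr V ht)) ∨
      ((∀ s : S, ¬ x ≤ (s : P)) ∧ Subsingleton (V.obj x))) :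
    IsIso (((coinductionAdjunction k S).unit.app V).app x) := by
  rcases h with ⟨t, htx, ht, hV⟩ | ⟨hx, hV⟩
  · let f : x ⟶ (inclusion S).obj t := homOfLE htx
    have h1 := isIso_map_ranCounit f ht ((restriction k S).obj V)
    have h2 : IsIso (V.map f) := (ConcreteCategory.isIso_iff_bijective _).2 hV
    exact isIso_of_comm_right h1 h2 (((coinductionAdjunction k S).unit.app V).naturality f)
      (congr_app ((coinductionAdjunction k S).left_triangle_components V) t)
  · have hE : IsEmpty (StructuredArrow x (inclusion S)) := ⟨fun Z => hx Z.right (leOfHom Z.hom)⟩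
    have h0 : IsZero (((inclusion S).ran.obj ((restriction k S).obj V)).obj x) :=
      (IsZero.iff_id_eq_zero _).2
        ((Functor.isPointwiseRightKanExtensionRanCounit (inclusion S) _ x).hom_ext
          fun j => isEmptyElim j)
    exact (ModuleCat.isZero_of_subsingleton (V.obj x)).isIso h0 _

/-- A representation that vanishes outside `[a, ∞)` and is constant on `[b, ∞)` is induced from the
clamped interval `[a, b]`. -/
lemma isIso_counit_app (a b : P) [hab : IsClamped a b] (V : PosetRep k P)
    (h0 : ∀ x, ¬ a ≤ x → Subsingleton (V.obj x))
    (h1 : ∀ (x : P) (hx : b ≤ x), Function.Bijective (tr V hx)) :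
    IsIso ((inductionAdjunction k (Set.Icc a b)).counit.app V) := by
  have : ∀ x, IsIso (((inductionAdjunction k (Set.Icc a b)).counit.app V).app x) := fun x => by
    apply isIso_counit_app_app
    by_cases hax : a ≤ x
    · left
      rcases hab.above x hax with hxb | hbx
      · refine ⟨⟨x, hax, hxb⟩, le_rfl, fun s hs => hs, ?_⟩
        convert Function.bijective_id using 1
        exact funext fun v => tr_self V le_rfl v
      · exact ⟨⟨b, hab.le, le_rfl⟩, hbx, fun s _ => s.2.2, h1 x hbx⟩
    · exact Or.inr ⟨fun s hs => hax (s.2.1.trans hs), h0 x hax⟩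
  exact NatIso.isIso_of_isIso_app _

/-- A representation that vanishes outside `(-∞, b]` and is constant on `(-∞, a]` is coinduced from
the clamped interval `[a, b]`. -/
lemma isIso_unit_app (a b : P) [hab : IsClamped a b] (V : PosetRep k P)
    (h0 : ∀ x, ¬ x ≤ b → Subsingleton (V.obj x))
    (h1 : ∀ (x : P) (hx : x ≤ a), Function.Bijective (tr V hx)) :
    IsIso ((coinductionAdjunction k (Set.Icc a b)).unit.app V) := by
  have : ∀ x, IsIso (((coinductionAdjunction k (Set.Icc a b)).unit.app V).app x) := fun x => by
    apply isIso_unit_app_app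
    by_cases hxb : x ≤ b
    · left
      rcases hab.below x hxb with hax | hxa
      · refine ⟨⟨x, hax, hxb⟩, le_rfl, fun s hs => hs, ?_⟩
        convert Function.bijective_id using 1
        exact funext fun v => tr_self V le_rfl v
      · exact ⟨⟨a, le_rfl, hab.le⟩, hxa, fun s _ => s.2.1, h1 x hxa⟩
    · exact Or.inr ⟨fun s hs => hxb (hs.trans s.2.2), h0 x hxb⟩
  exact NatIso.isIso_of_isIso_app _

instance inclusion_full (S : Set P) : (inclusion S).Full where
  map_surjective f := ⟨homOfLE (leOfHom f), rfl⟩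

instance inclusion_faithful (S : Set P) : (inclusion S).Faithful where
  map_injective _ := Subsingleton.elim _ _

/-- The inclusion of a subposet is fully faithful, so restricting a Kan extension gives back the
original representation. -/
instance isIso_inductionAdjunction_unit (S : Set P) : IsIso (inductionAdjunction k S).unit :=
  inferInstanceAs (IsIso ((inclusion S).lanAdjunction (ModuleCat.{u} k)).unit)

instance isIso_coinductionAdjunction_counit (S : Set P) :
    IsIso (coinductionAdjunction k S).counit :=
  inferInstanceAs (IsIso ((inclusion S).ranAdjunction (ModuleCat.{u} k)).counit)

instance induction_full (S : Set P) : (induction k S).Full :=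
  (inductionAdjunction k S).fullyFaithfulLOfIsIsoUnit.full

instance induction_faithful (S : Set P) : (induction k S).Faithful :=
  (inductionAdjunction k S).fullyFaithfulLOfIsIsoUnit.faithful

instance coinduction_full (S : Set P) : (coinduction k S).Full :=
  (coinductionAdjunction k S).fullyFaithfulROfIsIsoCounit.full

instance coinduction_faithful (S : Set P) : (coinduction k S).Faithful :=
  (coinductionAdjunction k S).fullyFaithfulROfIsIsoCounit.faithful

/-- A projective representation that is induced from `S` restricts to a projective one. -/
lemma projective_restriction {S : Set P} (V : PosetRep k P) [Projective V]
    [IsIso ((inductionAdjunction k S).counit.app V)] : Projective ((restriction k S).obj V) := by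
  have : Projective ((induction k S).obj ((restriction k S).obj V)) :=
    Projective.of_iso (asIso ((inductionAdjunction k S).counit.app V)).symm inferInstance
  -- Induction is full, faithful and preserves epimorphisms, so a lifting problem can be solved
  -- after inducing.
  exact (induction k S).projective_of_map_projective this

/-- An injective representation that is coinduced from `S` restricts to an injective one. -/
lemma injective_restriction {S : Set P} (V : PosetRep k P) [Injective V]
    [IsIso ((coinductionAdjunction k S).unit.app V)] : Injective ((restriction k S).obj V) := by
  have : Injective ((coinduction k S).obj ((restriction k S).obj V)) :=
    Injective.of_iso (asIso ((coinductionAdjunction k S).unit.app V)) inferInstance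
  exact (coinduction k S).injective_of_map_injective this

end Counit

/-! ### Minimal resolutions of complexes supported on a clamped interval -/

section Minimal

variable {k : Type u} [Field k] {P : Type u} [PartialOrder P] [Finite P] (a b : P)
  [hab : IsClamped a b]

/-- By induction from below the terms vanish at all `y < x`, so their radicals vanish at `x`.
Minimality makes the differentials zero at `x`, and the terms there equal their homology. -/
lemma subsingleton_of_minimal_projective {R : CochainComplex (PosetRep k P) ℤ}
    (hmin : ∀ (i j : ℤ) (y : P), LinearMap.range (at' (R.d i j) y) ≤ radical (R.X j) y)
    (hR : ∀ (i : ℤ) (x : P), ¬ a ≤ x → IsZero ((R.homology i).obj x)) (x : P) (hx : ¬ a ≤ x)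
    (i : ℤ) : Subsingleton ((R.X i).obj x) := by
  induction x using WellFoundedLT.induction generalizing i with
  | ind x ih =>
    have hrad : ∀ j, radical (R.X j) x ≤ ⊥ := fun j => radical_le fun y hy v => by
      have := ih y hy (fun h => hx (h.trans hy.le)) j
      rw [Subsingleton.elim v 0, map_zero]
      exact zero_mem _
    have hd : ∀ i j (v : (R.X i).obj x), at' (R.d i j) x v = 0 := fun i j v =>
      (Submodule.mem_bot k).1 (hrad j (hmin i j x ⟨v, rfl⟩))
    refine subsingleton_of_forall_eq 0 fun v => ?_
    obtain ⟨u, rfl⟩ := exists_boundary R (sub_add_cancel i 1) rfl (hR i x hx) v (hd _ _ _)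
    exact hd _ _ _

/-- By induction on `x` the radical at `x` comes from `b`, hence so do all boundaries at `x`.
Exactness at `b` and at `x` extends this to arbitrary vectors. -/
lemma bijective_of_minimal_projective {R : CochainComplex (PosetRep k P) ℤ}
    [hp : ∀ i, Projective (R.X i)]
    (hmin : ∀ (i j : ℤ) (y : P), LinearMap.range (at' (R.d i j) y) ≤ radical (R.X j) y)
    (hR : HomologySupportedOn (Set.Ico a b) R) (x : P) (hx : b ≤ x) (i : ℤ) :
    Function.Bijective (tr (R.X i) hx) := by
  refine ⟨tr_injective_of_projective _ _, ?_⟩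
  induction x using WellFoundedLT.induction generalizing i with
  | ind x ih =>
    have hrad : ∀ j, radical (R.X j) x ≤ LinearMap.range (tr (R.X j) hx) := fun j =>
      radical_le fun y hy v => by
        by_cases hay : a ≤ y
        · rcases hab.above y hay with hyb | hby
          · exact ⟨tr _ hyb v, tr_tr _ _ _ _⟩
          · obtain ⟨w, rfl⟩ := ih y hy hby j v
            exact ⟨w, (tr_tr _ _ _ _).symm⟩
        · have := subsingleton_of_minimal_projective a hmin
            (fun i x hx => hR i x fun h => hx h.1) y hay j
          rw [Subsingleton.elim v 0, map_zero]
          exact zero_mem _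
    intro v
    obtain ⟨w, hw⟩ := hrad (i + 1) (hmin i (i + 1) x ⟨v, rfl⟩)
    -- `w` is a cycle at `b` because its image `d v` at `x` is one and transitions in degree `i + 2`
    -- are injective. Since `b ∉ [a, b)`, it is a boundary `d w'`.
    have hw0 : at' (R.d (i + 1) (i + 2)) b w = 0 := by
      apply tr_injective_of_projective (R.X (i + 2)) hx
      rw [← at_tr, hw, at_d_d, map_zero]
    obtain ⟨w', rfl⟩ := exists_boundary R (rfl : i + 1 = i + 1) (by ring)
      (hR (i + 1) b fun h => lt_irrefl _ h.2) w hw0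
    rw [← at_tr] at hw
    -- `v` and the image of `w'` have the same differential. Their difference is a cycle at `x ∉ [a,
    -- b)`, so a boundary, so in the radical, and comes from `b`.
    obtain ⟨u, hu⟩ := exists_boundary R (sub_add_cancel i 1) rfl
      (hR i x fun h => (h.2.trans_le hx).false) (v - tr (R.X i) hx w') (by
        rw [map_sub, ← hw, sub_self])
    obtain ⟨t, ht⟩ := hrad i (hmin (i - 1) i x ⟨u, rfl⟩)
    exact ⟨t + w', by rw [map_add, ht, hu, sub_add_cancel]⟩

/-- By induction from above the terms vanish at all `y > x`, so every vector at `x` lies in the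
socle. The differentials vanish there, and the terms equal their homology. -/
lemma subsingleton_of_minimal_injective {R : CochainComplex (PosetRep k P) ℤ}
    (hmin : ∀ (i j : ℤ) (y : P), socle (R.X i) y ≤ LinearMap.ker (at' (R.d i j) y))
    (hR : ∀ (i : ℤ) (x : P), ¬ x ≤ b → IsZero ((R.homology i).obj x)) (x : P) (hx : ¬ x ≤ b)
    (i : ℤ) : Subsingleton ((R.X i).obj x) := by
  induction x using WellFoundedGT.induction generalizing i with
  | ind x ih =>
    have hsoc : ∀ j (v : (R.X j).obj x), v ∈ socle (R.X j) x := fun j v =>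
      mem_socle.2 fun y hy => by
        have := ih y hy (fun h => hx (hy.le.trans h)) j
        exact Subsingleton.elim _ _
    have hd : ∀ i j (v : (R.X i).obj x), at' (R.d i j) x v = 0 := fun i j v =>
      hmin i j x (hsoc i v)
    refine subsingleton_of_forall_eq 0 fun v => ?_
    obtain ⟨u, rfl⟩ := exists_boundary R (sub_add_cancel i 1) rfl (hR i x hx) v (hd _ _ _)
    exact hd _ _ _

/-- By induction from above the kernel of the transition to `a` lies in the socle, which the
differential kills. A kernel vector is thus a cycle `d u`, and exactness at `a` allows `u` to be
corrected into that kernel. -/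
lemma bijective_of_minimal_injective {R : CochainComplex (PosetRep k P) ℤ}
    [hp : ∀ i, Injective (R.X i)]
    (hmin : ∀ (i j : ℤ) (y : P), socle (R.X i) y ≤ LinearMap.ker (at' (R.d i j) y))
    (hR : HomologySupportedOn (Set.Ioc a b) R) (x : P) (hx : x ≤ a) (i : ℤ) :
    Function.Bijective (tr (R.X i) hx) := by
  refine ⟨?_, tr_surjective_of_injective _ _⟩
  induction x using WellFoundedGT.induction generalizing i with
  | ind x ih =>
    have hsoc : ∀ j (v : (R.X j).obj x), tr (R.X j) hx v = 0 → v ∈ socle (R.X j) x :=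
      fun j v hv => mem_socle.2 fun y hy => by
        by_cases hyb : y ≤ b
        · rcases hab.below y hyb with hay | hya
          · rw [← tr_tr _ hx hay, hv, map_zero]
          · apply ih y hy hya j
            rw [tr_tr, hv, map_zero]
        · have := subsingleton_of_minimal_injective b hmin
            (fun i x hx => hR i x fun h => hx h.2) y hyb j
          exact Subsingleton.elim _ _
    rw [injective_iff_map_eq_zero]
    intro v hv
    obtain ⟨u, rfl⟩ := exists_boundary R (sub_add_cancel i 1) rfl
      (hR i x fun h => (h.1.trans_le hx).false) v (hmin i (i + 1) x (hsoc i v hv))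
    rw [← at_tr] at hv
    -- The image of `u` at `a` is a cycle, hence a boundary `d w` because `a ∉ (a, b]`; `w` lifts to
    -- `x` by surjectivity of transitions.
    obtain ⟨w, hw⟩ := exists_boundary R (i := i - 2) (by ring) (sub_add_cancel i 1)
      (hR (i - 1) a fun h => lt_irrefl _ h.1) (tr (R.X (i - 1)) hx u) hv
    obtain ⟨w', rfl⟩ := tr_surjective_of_injective (R.X (i - 2)) hx w
    -- Subtracting `d w'` does not change `d u`, but puts `u` in the kernel of the transition, so in
    -- the socle, where `d` vanishes.
    have h1 := hmin (i - 1) i x (hsoc (i - 1) (u - at' (R.d (i - 2) (i - 1)) x w') (by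
      rw [map_sub, ← at_tr, hw, sub_self]))
    rwa [LinearMap.mem_ker, map_sub, at_d_d, sub_zero] at h1

/-- A minimal complex of projectives with homology supported on `[a, b)` is induced. -/
lemma isIso_counit_of_minimal {R : CochainComplex (PosetRep k P) ℤ}
    [hp : ∀ i, Projective (R.X i)]
    (hmin : ∀ (i j : ℤ) (y : P), LinearMap.range (at' (R.d i j) y) ≤ radical (R.X j) y)
    (hR : HomologySupportedOn (Set.Ico a b) R) (i : ℤ) :
    IsIso ((inductionAdjunction k (Set.Icc a b)).counit.app (R.X i)) :=
  isIso_counit_app a b _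
    (fun x hx => subsingleton_of_minimal_projective a hmin
      (fun i x hx => hR i x fun h => hx h.1) x hx i)
    (fun x hx => bijective_of_minimal_projective a b hmin hR x hx i)

lemma isIso_unit_of_minimal {R : CochainComplex (PosetRep k P) ℤ}
    [hp : ∀ i, Injective (R.X i)]
    (hmin : ∀ (i j : ℤ) (y : P), socle (R.X i) y ≤ LinearMap.ker (at' (R.d i j) y))
    (hR : HomologySupportedOn (Set.Ioc a b) R) (i : ℤ) :
    IsIso ((coinductionAdjunction k (Set.Icc a b)).unit.app (R.X i)) :=
  isIso_unit_app a b _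
    (fun x hx => subsingleton_of_minimal_injective b hmin
      (fun i x hx => hR i x fun h => hx h.2) x hx i)
    (fun x hx => bijective_of_minimal_injective a b hmin hR x hx i)

/-- A summand `P_x` requires a vector outside the radical at `x`. Off `[a, ∞)` there are no nonzero
vectors, and strictly above `b` every vector comes from `b`. -/
lemma isDirectSumFrom_proj_of_minimal {R : CochainComplex (PosetRep k P) ℤ}
    [hp : ∀ i, Projective (R.X i)]
    (hmin : ∀ (i j : ℤ) (y : P), LinearMap.range (at' (R.d i j) y) ≤ radical (R.X j) y)
    (hR : HomologySupportedOn (Set.Ico a b) R) (i : ℤ) :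
    IsDirectSumFrom (proj k) (Set.Icc a b) (R.X i) := by
  refine isDirectSumFrom_proj _ fun x hx => ?_
  by_cases hax : a ≤ x
  · have hxb : ¬ x ≤ b := fun h => hx ⟨hax, h⟩
    have hbx := (hab.above x hax).resolve_left hxb
    refine eq_top_iff.2 fun v _ => ?_
    obtain ⟨w, rfl⟩ := (bijective_of_minimal_projective a b hmin hR x hbx i).2 v
    exact tr_mem_radical _ (lt_of_le_not_ge hbx hxb) w
  · have := subsingleton_of_minimal_projective a hmin
      (fun i x hx => hR i x fun h => hx h.1) x hax i
    exact Subsingleton.elim _ _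

/-- A summand `I_x` requires a nonzero socle vector at `x`. Off `(-∞, b]` there is none, and
strictly below `a` the transition to `a` is injective but kills the socle. -/
lemma isDirectSumFrom_inj_of_minimal {R : CochainComplex (PosetRep k P) ℤ}
    [hp : ∀ i, Injective (R.X i)]
    (hmin : ∀ (i j : ℤ) (y : P), socle (R.X i) y ≤ LinearMap.ker (at' (R.d i j) y))
    (hR : HomologySupportedOn (Set.Ioc a b) R) (i : ℤ) :
    IsDirectSumFrom (inj k) (Set.Icc a b) (R.X i) := by
  refine isDirectSumFrom_inj _ fun x hx => ?_
  by_cases hxb : x ≤ b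
  · have hax : ¬ a ≤ x := fun h => hx ⟨h, hxb⟩
    have hxa := (hab.below x hxb).resolve_left hax
    refine eq_bot_iff.2 fun v hv => ?_
    apply (bijective_of_minimal_injective a b hmin hR x hxa i).1
    rw [mem_socle.1 hv a (lt_of_le_not_ge hxa hax), map_zero]
  · have := subsingleton_of_minimal_injective b hmin
      (fun i x hx => hR i x fun h => hx h.2) x hxb i
    exact Subsingleton.elim _ _

end Minimal

/-! ### Finite dimensionality of minimal resolutions. -/

section FiniteDimensional

variable {k : Type u} [Field k] {P : Type u} [PartialOrder P] [Finite P]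

/-- Descending induction from the degrees where the terms vanish. A complement of the cycles embeds
in the next term, and the cycles are boundaries plus representatives of homology. As boundaries lie
in the radical, the top is finite dimensional. -/
lemma isFiniteDimensional_of_minimal_projective {R : CochainComplex (PosetRep k P) ℤ}
    (hbd : ∃ n : ℤ, ∀ i : ℤ, n < i → IsZero (R.X i))
    (hmin : ∀ (i j : ℤ) (y : P), LinearMap.range (at' (R.d i j) y) ≤ radical (R.X j) y)
    (hR : ∀ i, IsFiniteDimensional (R.homology i)) (i : ℤ) : IsFiniteDimensional (R.X i) := by
  obtain ⟨n, hn⟩ := hbd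
  have key : ∀ (m : ℕ) (i : ℤ), n - m < i → IsFiniteDimensional (R.X i) := fun m => by
    induction m with
    | zero =>
      intro i hi x
      have := ModuleCat.subsingleton_of_isZero ((hn i (by simpa using hi)).obj x)
      infer_instance
    | succ m ih =>
      intro i hi
      have ih' := ih (i + 1) (by push_cast at hi; omega)
      refine finiteDimensional_of_radical fun y => ?_
      obtain ⟨U, hU, hUk⟩ := exists_finiteDimensional_cycles R (sub_add_cancel i 1) rfl (hR i y)
      have := ih' y
      obtain ⟨C, hC⟩ := Submodule.exists_isCompl (LinearMap.ker (at' (R.d i (i + 1)) y))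
      have : FiniteDimensional k C := by
        have : FiniteDimensional k (_ ⧸ LinearMap.ker (at' (R.d i (i + 1)) y)) :=
          Module.Finite.equiv (at' (R.d i (i + 1)) y).quotKerEquivRange.symm
        exact Module.Finite.equiv (Submodule.quotientEquivOfIsCompl _ _ hC)
      refine ⟨U ⊔ C, inferInstance, eq_top_iff.2 ?_⟩
      rw [← hC.sup_eq_top, ← hUk]
      refine sup_le (sup_le (le_sup_left.trans le_sup_left) ?_) (le_sup_right.trans le_sup_left)
      exact (hmin _ _ _).trans le_sup_right
  -- This choice gives `n - m < i`, also when `n - i + 1` is negative and truncates to zero.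
  exact key (n - i + 1).toNat i (by omega)

/-- Ascending induction: the socle lies in the cycles, which are boundaries of the previous term
plus representatives of homology. -/
lemma isFiniteDimensional_of_minimal_injective {R : CochainComplex (PosetRep k P) ℤ}
    (hbd : ∃ n : ℤ, ∀ i : ℤ, i < n → IsZero (R.X i))
    (hmin : ∀ (i j : ℤ) (y : P), socle (R.X i) y ≤ LinearMap.ker (at' (R.d i j) y))
    (hR : ∀ i, IsFiniteDimensional (R.homology i)) (i : ℤ) : IsFiniteDimensional (R.X i) := by
  obtain ⟨n, hn⟩ := hbd
  have key : ∀ (m : ℕ) (i : ℤ), i < n + m → IsFiniteDimensional (R.X i) := fun m => by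
    induction m with
    | zero =>
      intro i hi x
      have := ModuleCat.subsingleton_of_isZero ((hn i (by simpa using hi)).obj x)
      infer_instance
    | succ m ih =>
      intro i hi
      have ih' := ih (i - 1) (by push_cast at hi; omega)
      refine finiteDimensional_of_socle fun y => ?_
      obtain ⟨U, hU, hUk⟩ := exists_finiteDimensional_cycles R (sub_add_cancel i 1) rfl (hR i y)
      have := ih' y
      have : FiniteDimensional k (LinearMap.ker (at' (R.d i (i + 1)) y)) := by
        rw [← hUk]; infer_instance
      exact Submodule.finiteDimensional_of_le (hmin i (i + 1) y)
  exact key (i - n + 1).toNat i (by omega)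

end FiniteDimensional

/-! ### Quasi-isomorphisms from natural transformations between exact functors -/

section NatTrans

variable {A B : Type*} [Category* A] [Category* B] [Abelian A] [Abelian B]

/-- Exact functors commute with homology, so the map on homology in degree `i` is `τ` at `K.homology
i` up to isomorphism. This reduces questions about derived functors to single representations. -/
lemma quasiIso_mapHomologicalComplex_app {F G : A ⥤ B} [F.Additive] [G.Additive]
    [PreservesFiniteLimits F] [PreservesFiniteColimits F]
    [PreservesFiniteLimits G] [PreservesFiniteColimits G] (τ : F ⟶ G)
    (K : CochainComplex A ℤ) (h : ∀ i, IsIso (τ.app (K.homology i))) :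
    QuasiIso ((NatTrans.mapHomologicalComplex τ (ComplexShape.up ℤ)).app K) := by
  refine ⟨fun i => ?_⟩
  rw [quasiIsoAt_iff]
  refine (ShortComplex.quasiIso_iff _).2 ?_
  change IsIso (ShortComplex.homologyMap ((K.sc i).mapNatTrans τ))
  rw [ShortComplex.homologyMap_mapNatTrans]
  have : IsIso (τ.app (K.sc i).homology) := h i
  infer_instance

lemma isIso_Q_map [HasDerivedCategory.{w₁} A] {K L : CochainComplex A ℤ} (f : K ⟶ L) [QuasiIso f] :
    IsIso (DerivedCategory.Q.map f) :=
  Localization.inverts DerivedCategory.Q (HomologicalComplex.quasiIso A (ComplexShape.up ℤ)) f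
    ‹QuasiIso f›

end NatTrans

/-! ### Derived units and counits, tested on homology. -/

section Derived

variable {k : Type u} [Field k] {P : Type u} [PartialOrder P]

lemma quasiIso_inductionAdjunction_counit (S : Set P) [PreservesFiniteLimits (induction k S)]
    (M : CochainComplex (PosetRep k P) ℤ)
    (h : ∀ i, IsIso ((inductionAdjunction k S).counit.app (M.homology i))) :
    QuasiIso ((complexAdjunction (inductionAdjunction k S)).counit.app M) :=
  quasiIso_mapHomologicalComplex_app (inductionAdjunction k S).counit M h

lemma quasiIso_coinductionAdjunction_unit (S : Set P) [PreservesFiniteColimits (coinduction k S)]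
    (M : CochainComplex (PosetRep k P) ℤ)
    (h : ∀ i, IsIso ((coinductionAdjunction k S).unit.app (M.homology i))) :
    QuasiIso ((complexAdjunction (coinductionAdjunction k S)).unit.app M) :=
  quasiIso_mapHomologicalComplex_app (coinductionAdjunction k S).unit M h

variable [HasDerivedCategory.{w₁} (PosetRep k P)]

lemma bounded_Q_obj {M : CochainComplex (PosetRep k P) ℤ} (hM : BoundedHomology M) :
    DerivedCategory.TStructure.t.bounded (DerivedCategory.Q.obj M) := by
  obtain ⟨m, n, h⟩ := hM
  refine ⟨⟨m, (DerivedCategory.isGE_Q_obj_iff M m).2 ?_⟩,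
    ⟨n, (DerivedCategory.isLE_Q_obj_iff M n).2 ?_⟩⟩
  · rw [CochainComplex.isGE_iff]
    exact fun i hi => (HomologicalComplex.exactAt_iff_isZero_homology _ _).2 (h i (Or.inl hi))
  · rw [CochainComplex.isLE_iff]
    exact fun i hi => (HomologicalComplex.exactAt_iff_isZero_homology _ _).2 (h i (Or.inr hi))

variable (S : Set P) [HasDerivedCategory.{w₂} (PosetRep k S)]

lemma bounded_derivedRestriction {M : CochainComplex (PosetRep k P) ℤ} (hM : BoundedHomology M) :
    DerivedCategory.TStructure.t.bounded
      ((derivedRestriction k S).obj (DerivedCategory.Q.obj M)) := by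
  refine ObjectProperty.prop_of_iso _ ((derivedRestrictionFactors k S).app M).symm
    (bounded_Q_obj ?_)
  obtain ⟨m, n, h⟩ := hM
  refine ⟨m, n, fun i hi => ?_⟩
  exact ((restriction k S).map_isZero (h i hi)).of_iso ((M.sc i).mapHomologyIso (restriction k S))

/-- As induction is exact, the comparison of derived with termwise induction is invertible. Up to
isomorphism the derived counit is then the image of the termwise one. -/
lemma isIso_derivedInductionAdjunction_counit [PreservesFiniteLimits (induction k S)]
    (M : CochainComplex (PosetRep k P) ℤ)
    (h : ∀ i, IsIso ((inductionAdjunction k S).counit.app (M.homology i))) :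
    IsIso ((derivedInductionAdjunction k S).counit.app (DerivedCategory.Q.obj M)) := by
  have h1 : (derivedInduction k S).map ((derivedRestrictionFactors k S).inv.app M) ≫
      (derivedInductionAdjunction k S).counit.app (DerivedCategory.Q.obj M) =
      (derivedInductionCounit k S).app ((restrictionComplex k S).obj M) ≫
        DerivedCategory.Q.map ((complexAdjunction (inductionAdjunction k S)).counit.app M) := by
    -- This structure enters the construction of `derivedInductionAdjunction`, and the formula for
    -- its counit presupposes it.
    have : (derivedRestriction k S ⋙ derivedInduction k S).IsRightDerivedFunctor
        (Functor.whiskerRight (derivedRestrictionFactors k S).inv (derivedInduction k S) ≫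
          (Functor.associator _ _ _).hom)
        (HomologicalComplex.quasiIso _ _) :=
      Functor.isRightDerivedFunctor_of_inverts _ _ ((Functor.associator _ _ _).symm ≪≫
        Functor.isoWhiskerRight (derivedRestrictionFactors k S) (derivedInduction k S))
    exact Adjunction.derivedε_fac_app (complexAdjunction (inductionAdjunction k S))
      (HomologicalComplex.quasiIso _ _) (derivedInductionCounit k S)
      (derivedRestrictionFactors k S).inv M
  have := quasiIso_inductionAdjunction_counit S M h
  have := isIso_Q_map ((complexAdjunction (inductionAdjunction k S)).counit.app M)
  have h2 : IsIso ((derivedInductionCounit k S).app ((restrictionComplex k S).obj M) ≫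
        DerivedCategory.Q.map ((complexAdjunction (inductionAdjunction k S)).counit.app M)) :=
    IsIso.comp_isIso
  exact IsIso.of_isIso_fac_left h1

lemma isIso_derivedCoinductionAdjunction_unit [PreservesFiniteColimits (coinduction k S)]
    (M : CochainComplex (PosetRep k P) ℤ)
    (h : ∀ i, IsIso ((coinductionAdjunction k S).unit.app (M.homology i))) :
    IsIso ((derivedCoinductionAdjunction k S).unit.app (DerivedCategory.Q.obj M)) := by
  have h1 : (derivedCoinductionAdjunction k S).unit.app (DerivedCategory.Q.obj M) ≫
      (derivedCoinduction k S).map ((derivedRestrictionFactors k S).hom.app M) =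
        DerivedCategory.Q.map ((complexAdjunction (coinductionAdjunction k S)).unit.app M) ≫
      (derivedCoinductionUnit k S).app ((restrictionComplex k S).obj M) := by
    have : (derivedRestriction k S ⋙ derivedCoinduction k S).IsLeftDerivedFunctor
        ((Functor.associator _ _ _).inv ≫
          Functor.whiskerRight (derivedRestrictionFactors k S).hom (derivedCoinduction k S))
        (HomologicalComplex.quasiIso _ _) :=
      Functor.isLeftDerivedFunctor_of_inverts _ _ ((Functor.associator _ _ _).symm ≪≫
        Functor.isoWhiskerRight (derivedRestrictionFactors k S) (derivedCoinduction k S))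
    exact Adjunction.derivedη_fac_app (complexAdjunction (coinductionAdjunction k S))
      (HomologicalComplex.quasiIso _ _) (derivedRestrictionFactors k S).hom
      (derivedCoinductionUnit k S) M
  have := quasiIso_coinductionAdjunction_unit S M h
  have := isIso_Q_map ((complexAdjunction (coinductionAdjunction k S)).unit.app M)
  have h2 : IsIso (DerivedCategory.Q.map
      ((complexAdjunction (coinductionAdjunction k S)).unit.app M) ≫
      (derivedCoinductionUnit k S).app ((restrictionComplex k S).obj M)) :=
    IsIso.comp_isIso
  exact IsIso.of_isIso_fac_right h1

end Derived

/-! ### Comparison of induction and coinduction -/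

section Comparison

variable (k : Type u) [Field k] {P : Type u} [PartialOrder P]

/-- The canonical map from induction to coinduction. -/
noncomputable def inductionToCoinduction (S : Set P) : induction k S ⟶ coinduction k S :=
  (induction k S).rightUnitor.inv ≫
    Functor.whiskerLeft (induction k S) (coinductionAdjunction k S).unit ≫
    (Functor.associator _ _ _).inv ≫
    Functor.whiskerRight (inv (inductionAdjunction k S).unit) (coinduction k S) ≫
    (coinduction k S).leftUnitor.hom

variable {k}

/-- The comparison at `V` is the unit in the hypothesis followed by coinduction of the inverse of
the induction unit, which is always invertible. -/
lemma isIso_inductionToCoinduction_app {S : Set P} (V : PosetRep k S)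
    (h : IsIso ((coinductionAdjunction k S).unit.app ((induction k S).obj V))) :
    IsIso ((inductionToCoinduction k S).app V) := by
  have : (inductionToCoinduction k S).app V =
      (coinductionAdjunction k S).unit.app ((induction k S).obj V) ≫
        (coinduction k S).map ((inv (inductionAdjunction k S).unit).app V) := by
    simp only [inductionToCoinduction, NatTrans.comp_app, Functor.rightUnitor_inv_app,
      Functor.whiskerLeft_app, Functor.associator_inv_app, Functor.whiskerRight_app,
      Functor.leftUnitor_hom_app]
    erw [Category.id_comp, Category.id_comp, Category.comp_id]
  rw [this]
  infer_instance

lemma induction_obj_isZero {S : Set P} (V : PosetRep k S) (x : P)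
    (h : (∃ (t : S) (_ : (t : P) ≤ x), (∀ s : S, (s : P) ≤ x → s ≤ t) ∧ IsZero (V.obj t)) ∨
      (∀ s : S, ¬ (s : P) ≤ x)) : IsZero (((induction k S).obj V).obj x) := by
  rcases h with ⟨t, htx, ht, hV⟩ | hx
  · let f : (inclusion S).obj t ⟶ x := homOfLE htx
    have h1 := isIso_lanUnit_map f ht V
    exact hV.of_iso (@asIso _ _ _ _ _ h1).symm
  · have hE : IsEmpty (CostructuredArrow (inclusion S) x) := ⟨fun Z => hx Z.left (leOfHom Z.hom)⟩
    exact (IsZero.iff_id_eq_zero _).2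
        ((Functor.isPointwiseLeftKanExtensionLeftKanExtensionUnit (inclusion S) _ x).hom_ext
          fun j => isEmptyElim j)

/-- On representations supported on `(a, b)` induction and coinduction agree. -/
lemma isIso_inductionToCoinduction_of_support (a b : P) [hab : IsClamped a b]
    (V : PosetRep k (Set.Icc a b))
    (hV : ∀ x : Set.Icc a b, (x : P) ∉ Set.Ioo a b → IsZero (V.obj x)) :
    IsIso ((inductionToCoinduction k (Set.Icc a b)).app V) := by
  have h0 : ∀ x, x ∉ Set.Ioo a b → IsZero (((induction k (Set.Icc a b)).obj V).obj x) :=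
    fun x hx => by
      apply induction_obj_isZero
      by_cases hax : a ≤ x
      · left
        rcases hab.above x hax with hxb | hbx
        · exact ⟨⟨x, hax, hxb⟩, le_rfl, fun s hs => hs, hV _ hx⟩
        · exact ⟨⟨b, hab.le, le_rfl⟩, hbx, fun s _ => s.2.2, hV _ fun h => lt_irrefl _ h.2⟩
      · exact Or.inr fun s hs => hax (s.2.1.trans hs)
  -- The induced representation is again supported on `(a, b)`, so it meets the criterion for being
  -- coinduced: it is zero off `(-∞, b]` and zero on `(-∞, a]`.
  refine isIso_inductionToCoinduction_app _ (isIso_unit_app a b _ (fun x hx => ?_) fun x hx => ?_)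
  · exact ModuleCat.subsingleton_of_isZero (h0 x fun h => hx h.2.le)
  · have h1 := ModuleCat.subsingleton_of_isZero (h0 x fun h => (h.1.trans_le hx).false)
    have h2 := ModuleCat.subsingleton_of_isZero (h0 a fun h => lt_irrefl _ h.1)
    exact ⟨fun _ _ _ => Subsingleton.elim _ _, fun y => ⟨0, Subsingleton.elim _ _⟩⟩

variable [HasDerivedCategory.{w₁} (PosetRep k P)] (S : Set P)
  [HasDerivedCategory.{w₂} (PosetRep k S)]

/-- The canonical map from derived induction to derived coinduction. -/
noncomputable def derivedInductionToCoinduction [PreservesFiniteLimits (induction k S)]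
    [PreservesFiniteColimits (coinduction k S)] : derivedInduction k S ⟶ derivedCoinduction k S :=
  letI : Localization.Lifting DerivedCategory.Q (HomologicalComplex.quasiIso _ _)
    (inductionComplex k S ⋙ DerivedCategory.Q) (derivedInduction k S) :=
      ⟨asIso (derivedInductionCounit k S)⟩
  letI : Localization.Lifting DerivedCategory.Q (HomologicalComplex.quasiIso _ _)
    (coinductionComplex k S ⋙ DerivedCategory.Q) (derivedCoinduction k S) :=
      ⟨(asIso (derivedCoinductionUnit k S)).symm⟩
  Localization.liftNatTrans DerivedCategory.Q (HomologicalComplex.quasiIso _ _)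
    (inductionComplex k S ⋙ DerivedCategory.Q) (coinductionComplex k S ⋙ DerivedCategory.Q)
    (derivedInduction k S) (derivedCoinduction k S)
    (Functor.whiskerRight
      (NatTrans.mapHomologicalComplex (inductionToCoinduction k S) (ComplexShape.up ℤ))
      DerivedCategory.Q)

lemma isIso_derivedInductionToCoinduction_app [PreservesFiniteLimits (induction k S)]
    [PreservesFiniteColimits (coinduction k S)] (K : CochainComplex (PosetRep k S) ℤ)
    (h : ∀ i, IsIso ((inductionToCoinduction k S).app (K.homology i))) :
    IsIso ((derivedInductionToCoinduction S).app (DerivedCategory.Q.obj K)) := by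
  have := quasiIso_mapHomologicalComplex_app (inductionToCoinduction k S) K h
  have := isIso_Q_map ((NatTrans.mapHomologicalComplex (inductionToCoinduction k S)
    (ComplexShape.up ℤ)).app K)
  unfold derivedInductionToCoinduction
  rw [Localization.liftNatTrans_app]
  have : IsIso ((Functor.whiskerRight
      (NatTrans.mapHomologicalComplex (inductionToCoinduction k S) (ComplexShape.up ℤ))
      DerivedCategory.Q).app K) := this
  infer_instance

/-- On complexes with homology supported on `(a, b)`, derived induction and derived coinduction
are naturally isomorphic. -/
theorem nonempty_derivedInduction_iso_derivedCoinduction (a b : P) [IsClamped a b]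
    [HasDerivedCategory.{w₂} (PosetRep k (Set.Icc a b))] :
    Nonempty
      ((boundedSupportedOn (k := k) {x : Set.Icc a b | (x : P) ∈ Set.Ioo a b}).ι ⋙
          derivedInduction k (Set.Icc a b) ≅
        (boundedSupportedOn (k := k) {x : Set.Icc a b | (x : P) ∈ Set.Ioo a b}).ι ⋙
          derivedCoinduction k (Set.Icc a b)) := by
  have h (X : (boundedSupportedOn (k := k)
      {x : Set.Icc a b | (x : P) ∈ Set.Ioo a b}).FullSubcategory) :
      IsIso ((derivedInductionToCoinduction (k := k) (Set.Icc a b)).app X.obj) := by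
    -- `X` is represented by a complex, whose homology inherits the support condition.
    let e := DerivedCategory.Q.objObjPreimageIso X.obj
    have : IsIso ((derivedInductionToCoinduction (k := k) (Set.Icc a b)).app
        (DerivedCategory.Q.obj (DerivedCategory.Q.objPreimage X.obj))) := by
      refine isIso_derivedInductionToCoinduction_app _ _ fun i =>
        isIso_inductionToCoinduction_of_support a b _ fun x hx => ?_
      refine (X.property.2 i x hx).of_iso (Iso.app (F := HomologicalComplex.homology _ i) ?_ x)
      exact ((DerivedCategory.homologyFunctorFactors _ i).app _).symm ≪≫
        (DerivedCategory.homologyFunctor _ i).mapIso e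
    rw [← NatTrans.isIso_app_iff_of_iso _ e]
    exact this
  have : IsIso (Functor.whiskerLeft (boundedSupportedOn (k := k)
      {x : Set.Icc a b | (x : P) ∈ Set.Ioo a b}).ι
      (derivedInductionToCoinduction (k := k) (Set.Icc a b))) := by
    have : ∀ X, IsIso ((Functor.whiskerLeft (boundedSupportedOn (k := k)
      {x : Set.Icc a b | (x : P) ∈ Set.Ioo a b}).ι
      (derivedInductionToCoinduction (k := k) (Set.Icc a b))).app X) := h
    exact NatIso.isIso_of_isIso_app _
  exact ⟨asIso (Functor.whiskerLeft (boundedSupportedOn (k := k)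
      {x : Set.Icc a b | (x : P) ∈ Set.Ioo a b}).ι
      (derivedInductionToCoinduction (k := k) (Set.Icc a b)))⟩

end Comparison

/-! ### Homological algebra in an abelian category -/

section Abelian

variable {A : Type*} [Category* A] [Abelian A]

/-- Five lemma on the long exact homology sequence, as two four lemmas: a six-term window covers two
consecutive degrees, so the monomorphism uses degrees `i - 1, i` and the epimorphism `i, i + 1`. -/
lemma quasiIso_τ₂ {S₁ S₂ : ShortComplex (CochainComplex A ℤ)} (φ : S₁ ⟶ S₂)
    (h₁ : S₁.ShortExact) (h₂ : S₂.ShortExact) (hφ₁ : QuasiIso φ.τ₁) (hφ₃ : QuasiIso φ.τ₃) :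
    QuasiIso φ.τ₂ := by
  rw [quasiIso_iff]
  intro i
  rw [quasiIsoAt_iff_isIso_homologyMap]
  have hm : Mono (HomologicalComplex.homologyMap φ.τ₂ i) := by
    have hij : (ComplexShape.up ℤ).Rel (i - 1) i := sub_add_cancel i 1
    exact Abelian.mono_of_epi_of_mono_of_mono'' (n := 5) (k := 2) (by norm_num)
      (HomologicalComplex.HomologySequence.composableArrows₅_exact h₁ (i - 1) i hij)
      (HomologicalComplex.HomologySequence.composableArrows₅_exact h₂ (i - 1) i hij)
      (HomologicalComplex.HomologySequence.mapComposableArrows₅ φ h₁ h₂ (i - 1) i hij)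
      2 3 4 5 rfl rfl rfl rfl
      (inferInstance : Epi (HomologicalComplex.homologyMap φ.τ₃ (i - 1)))
      (inferInstance : Mono (HomologicalComplex.homologyMap φ.τ₁ i))
      (inferInstance : Mono (HomologicalComplex.homologyMap φ.τ₃ i))
  have he : Epi (HomologicalComplex.homologyMap φ.τ₂ i) := by
    have hij : (ComplexShape.up ℤ).Rel i (i + 1) := rfl
    exact Abelian.epi_of_epi_of_epi_of_mono'' (n := 5) (k := 0) (by norm_num)
      (HomologicalComplex.HomologySequence.composableArrows₅_exact h₁ i (i + 1) hij)
      (HomologicalComplex.HomologySequence.composableArrows₅_exact h₂ i (i + 1) hij)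
      (HomologicalComplex.HomologySequence.mapComposableArrows₅ φ h₁ h₂ i (i + 1) hij)
      0 1 2 3 rfl rfl rfl rfl
      (inferInstance : Epi (HomologicalComplex.homologyMap φ.τ₁ i))
      (inferInstance : Epi (HomologicalComplex.homologyMap φ.τ₃ i))
      (inferInstance : Mono (HomologicalComplex.homologyMap φ.τ₁ (i + 1)))
  exact isIso_of_mono_of_epi _

lemma acyclic_mappingCone_id (K : CochainComplex A ℤ) :
    (CochainComplex.mappingCone (𝟙 K)).Acyclic := fun i => by
  rw [HomologicalComplex.exactAt_iff_isZero_homology, IsZero.iff_id_eq_zero,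
    ← HomologicalComplex.homologyMap_id,
    (CochainComplex.mappingCone.homotopyToZeroOfId (K := K)).homologyMap_eq,
    HomologicalComplex.homologyMap_zero]

lemma quasiIso_biprod_inl (M K : CochainComplex A ℤ) (hK : K.Acyclic) :
    QuasiIso (biprod.inl : M ⟶ M ⊞ K) := by
  rw [quasiIso_iff]
  intro i
  rw [quasiIsoAt_iff_isIso_homologyMap]
  have h0 := (HomologicalComplex.exactAt_iff_isZero_homology _ _).1 (hK i)
  refine ⟨HomologicalComplex.homologyMap biprod.fst i, ?_, ?_⟩
  · rw [← HomologicalComplex.homologyMap_comp, biprod.inl_fst, HomologicalComplex.homologyMap_id]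
  · rw [← HomologicalComplex.homologyMap_comp, ← HomologicalComplex.homologyMap_id,
      ← biprod.total (X := M) (Y := K), HomologicalComplex.homologyMap_add,
      HomologicalComplex.homologyMap_comp biprod.snd,
      h0.eq_of_src (HomologicalComplex.homologyMap biprod.inr i) 0, comp_zero, add_zero]

lemma quasiIso_biprod_fst (M K : CochainComplex A ℤ) (hK : K.Acyclic) :
    QuasiIso (biprod.fst : M ⊞ K ⟶ M) := by
  have := quasiIso_biprod_inl M K hK
  have : QuasiIso ((biprod.inl : M ⟶ M ⊞ K) ≫ biprod.fst) := by
    rw [biprod.inl_fst]; infer_instance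
  exact quasiIso_of_comp_left (biprod.inl : M ⟶ M ⊞ K) biprod.fst

/-- Every morphism of complexes is a monomorphism followed by a quasi-isomorphism. -/
lemma exists_mono_quasiIso {E M : CochainComplex A ℤ} (f : E ⟶ M) :
    ∃ (T : CochainComplex A ℤ) (i : E ⟶ T) (p : T ⟶ M), Mono i ∧ QuasiIso p ∧ i ≫ p = f := by
  have h : Mono (CochainComplex.mappingCone.inr (𝟙 E)) := by
    have (n : ℤ) : Mono ((CochainComplex.mappingCone.inr (𝟙 E)).f n) :=
      mono_of_mono_fac (CochainComplex.mappingCone.inr_f_snd_v (𝟙 E) n)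
    exact HomologicalComplex.mono_of_mono_f _ this
  -- `E` embeds in the contractible cone of its identity; adding that cone to `M` makes `f` a
  -- monomorphism without changing homology.
  refine ⟨M ⊞ CochainComplex.mappingCone (𝟙 E),
    biprod.lift f (CochainComplex.mappingCone.inr (𝟙 E)), biprod.fst, ?_,
    quasiIso_biprod_fst _ _ (acyclic_mappingCone_id E), biprod.lift_fst _ _⟩
  exact mono_of_mono_fac (biprod.lift_snd f (CochainComplex.mappingCone.inr (𝟙 E)))

/-- Every morphism of complexes is a quasi-isomorphism followed by an epimorphism. -/
lemma exists_quasiIso_epi {E M : CochainComplex A ℤ} (f : M ⟶ E) :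
    ∃ (T : CochainComplex A ℤ) (i : M ⟶ T) (p : T ⟶ E), QuasiIso i ∧ Epi p ∧ i ≫ p = f := by
  -- The cone of the identity of `K` is contractible and surjects onto `K⟦1⟧`, so the shift by `-1`
  -- makes the target `E`.
  let K := E⟦(-1 : ℤ)⟧
  let e : K⟦(1 : ℤ)⟧ ≅ E := (shiftEquiv (CochainComplex A ℤ) (1 : ℤ)).counitIso.app E
  let q : CochainComplex.mappingCone (𝟙 K) ⟶ K⟦(1 : ℤ)⟧ :=
    (CochainComplex.mappingCone.triangle (𝟙 K)).mor₃
  have h : Epi q := by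
    have (n : ℤ) : Epi (q.f n) := by
      have := CochainComplex.mappingCone.inl_v_triangle_mor₃_f (𝟙 K) (n + 1) n (by omega)
      exact epi_of_epi_fac this
    exact HomologicalComplex.epi_of_epi_f _ this
  refine ⟨M ⊞ CochainComplex.mappingCone (𝟙 K), biprod.inl, biprod.desc f (q ≫ e.hom),
    quasiIso_biprod_inl _ _ (acyclic_mappingCone_id K), ?_, biprod.inl_desc _ _⟩
  exact epi_of_epi_fac (biprod.inr_desc f (q ≫ e.hom))

/-- The pullback of a short exact sequence of complexes along a quasi-isomorphism. -/
lemma exists_pullback_shortExact {S : ShortComplex (CochainComplex A ℤ)} (hS : S.ShortExact)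
    {R' : CochainComplex A ℤ} (ρ : R' ⟶ S.X₃) [QuasiIso ρ] :
    ∃ (R : CochainComplex A ℤ) (f : S.X₁ ⟶ R) (g : R ⟶ R') (w : f ≫ g = 0) (π : R ⟶ S.X₂),
      (ShortComplex.mk f g w).ShortExact ∧ QuasiIso π := by
  have := hS.mono_f
  have := hS.epi_g
  let f : S.X₁ ⟶ pullback S.g ρ := pullback.lift S.f 0 (by rw [S.zero, zero_comp])
  have hf : f ≫ pullback.fst S.g ρ = S.f := pullback.lift_fst _ _ _
  have w : f ≫ pullback.snd S.g ρ = 0 := pullback.lift_snd _ _ _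
  have hfm : Mono f := mono_of_mono_fac hf
  have hex : (ShortComplex.mk f (pullback.snd S.g ρ) w).ShortExact :=
    { exact := ShortComplex.exact_of_f_is_kernel _ <| KernelFork.IsLimit.ofι' f w fun t ht =>
        ⟨hS.exact.lift (t ≫ pullback.fst S.g ρ) (by
          rw [Category.assoc, pullback.condition, reassoc_of% ht, zero_comp]), by
          apply pullback.hom_ext
          · rw [Category.assoc, hf, hS.exact.lift_f]
          · rw [Category.assoc, w, comp_zero, ht]⟩
      mono_f := hfm
      epi_g := inferInstanceAs (Epi (pullback.snd S.g ρ)) }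
  let φ : ShortComplex.mk f (pullback.snd S.g ρ) w ⟶ S :=
    { τ₁ := 𝟙 _
      τ₂ := pullback.fst S.g ρ
      τ₃ := ρ
      comm₁₂ := by rw [Category.id_comp]; exact hf.symm
      comm₂₃ := pullback.condition }
  exact ⟨_, f, _, w, pullback.fst S.g ρ, hex,
    quasiIso_τ₂ φ hex hS (inferInstanceAs (QuasiIso (𝟙 S.X₁))) ‹_›⟩

/-- The pushout of a short exact sequence of complexes along a quasi-isomorphism. -/
lemma exists_pushout_shortExact {S : ShortComplex (CochainComplex A ℤ)} (hS : S.ShortExact)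
    {R' : CochainComplex A ℤ} (ρ : S.X₁ ⟶ R') [QuasiIso ρ] :
    ∃ (R : CochainComplex A ℤ) (f : R' ⟶ R) (g : R ⟶ S.X₃) (w : f ≫ g = 0) (ι : S.X₂ ⟶ R),
      (ShortComplex.mk f g w).ShortExact ∧ QuasiIso ι := by
  have := hS.mono_f
  have := hS.epi_g
  let g : pushout S.f ρ ⟶ S.X₃ := pushout.desc S.g 0 (by rw [S.zero, comp_zero])
  have hg : pushout.inl S.f ρ ≫ g = S.g := pushout.inl_desc _ _ _
  have w : pushout.inr S.f ρ ≫ g = 0 := pushout.inr_desc _ _ _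
  have hge : Epi g := epi_of_epi_fac hg
  have hex : (ShortComplex.mk (pushout.inr S.f ρ) g w).ShortExact :=
    { exact := ShortComplex.exact_of_g_is_cokernel _ <| CokernelCofork.IsColimit.ofπ' g w
        fun t ht =>
        ⟨hS.exact.desc (pushout.inl S.f ρ ≫ t) (by
          rw [pushout.condition_assoc, ht, comp_zero]), by
          apply pushout.hom_ext
          · rw [reassoc_of% hg, hS.exact.g_desc]
          · rw [reassoc_of% w, zero_comp, ht]⟩
      mono_f := inferInstanceAs (Mono (pushout.inr S.f ρ))
      epi_g := hge }
  let φ : S ⟶ ShortComplex.mk (pushout.inr S.f ρ) g w :=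
    { τ₁ := ρ
      τ₂ := pushout.inl S.f ρ
      τ₃ := 𝟙 _
      comm₁₂ := pushout.condition.symm
      comm₂₃ := by rw [Category.comp_id]; exact hg }
  exact ⟨_, _, g, w, pushout.inl S.f ρ, hex,
    quasiIso_τ₂ φ hS hex ‹_› (inferInstanceAs (QuasiIso (𝟙 S.X₃)))⟩

/-- If all objects are projective, every complex receives a quasi-isomorphism from a complex with
zero differentials. -/
lemma exists_quasiIso_from_homology (V : CochainComplex A ℤ)
    (hA : ∀ X : A, Projective X) : ∃ (D : CochainComplex A ℤ) (φ : D ⟶ V),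
      (∀ i, D.X i = V.homology i) ∧ (∀ i j, D.d i j = 0) ∧ QuasiIso φ := by
  -- Sections of cycles onto homology choose representatives; they form a chain map from the
  -- homology with zero differential.
  let s (i : ℤ) : V.homology i ⟶ V.cycles i := Projective.factorThru (𝟙 _) (V.homologyπ i)
  have hs (i : ℤ) : s i ≫ V.homologyπ i = 𝟙 _ := Projective.factorThru_comp _ _
  let D : CochainComplex A ℤ := { X := fun i => V.homology i, d := fun _ _ => 0 }
  have hD : ∀ i j, D.d i j = 0 := fun _ _ => rfl
  let φ : D ⟶ V :=
    { f := fun i => s i ≫ V.iCycles i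
      comm' := fun i j _ => by rw [hD, zero_comp, Category.assoc, V.iCycles_d, comp_zero] }
  refine ⟨D, φ, fun _ => rfl, hD, ?_⟩
  rw [quasiIso_iff]
  intro i
  rw [quasiIsoAt_iff_isIso_homologyMap]
  have h1 : IsIso (D.iCycles i) := D.isIso_iCycles i _ rfl (hD _ _)
  have h2 : IsIso (D.homologyπ i) := D.isIso_homologyπ _ i rfl (hD _ _)
  have h3 : HomologicalComplex.cyclesMap φ i = D.iCycles i ≫ s i := by
    rw [← cancel_mono (V.iCycles i), HomologicalComplex.cyclesMap_i, Category.assoc]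
  have h4 : D.homologyπ i ≫ HomologicalComplex.homologyMap φ i = D.iCycles i := by
    rw [HomologicalComplex.homologyπ_naturality, h3, Category.assoc, hs]
    exact Category.comp_id _
  have : IsIso (D.homologyπ i ≫ HomologicalComplex.homologyMap φ i) := h4 ▸ h1
  exact IsIso.of_isIso_comp_left (D.homologyπ i) _

/-- If all objects are injective, every complex has a quasi-isomorphism to a complex with
zero differentials. -/
lemma exists_quasiIso_to_homology (V : CochainComplex A ℤ)
    (hA : ∀ X : A, Injective X) : ∃ (D : CochainComplex A ℤ) (φ : V ⟶ D),
      (∀ i, D.X i = V.homology i) ∧ (∀ i j, D.d i j = 0) ∧ QuasiIso φ := by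
  let s (i : ℤ) : V.opcycles i ⟶ V.homology i := Injective.factorThru (𝟙 _) (V.homologyι i)
  have hs (i : ℤ) : V.homologyι i ≫ s i = 𝟙 _ := Injective.comp_factorThru _ _
  let D : CochainComplex A ℤ := { X := fun i => V.homology i, d := fun _ _ => 0 }
  have hD : ∀ i j, D.d i j = 0 := fun _ _ => rfl
  let φ : V ⟶ D :=
    { f := fun i => V.pOpcycles i ≫ s i
      comm' := fun i j _ => by rw [hD, comp_zero, V.d_pOpcycles_assoc, zero_comp] }
  refine ⟨D, φ, fun _ => rfl, hD, ?_⟩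
  rw [quasiIso_iff]
  intro i
  rw [quasiIsoAt_iff_isIso_homologyMap]
  have h1 : IsIso (D.pOpcycles i) := D.isIso_pOpcycles _ i rfl (hD _ _)
  have h2 : IsIso (D.homologyι i) := D.isIso_homologyι i _ rfl (hD _ _)
  have h3 : HomologicalComplex.opcyclesMap φ i = s i ≫ D.pOpcycles i := by
    rw [← cancel_epi (V.pOpcycles i), HomologicalComplex.p_opcyclesMap, Category.assoc]
  have h4 : HomologicalComplex.homologyMap φ i ≫ D.homologyι i = D.pOpcycles i := by
    rw [HomologicalComplex.homologyι_naturality, h3, reassoc_of% hs]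
  have : IsIso (HomologicalComplex.homologyMap φ i ≫ D.homologyι i) := h4 ▸ h1
  exact IsIso.of_isIso_comp_right _ (D.homologyι i)

end Abelian

/-! ### Adjoints of evaluation -/

section Evaluation

variable (k : Type u) [Field k] {P : Type u} [PartialOrder P]

/-- Evaluation of complexes of representations at `x`. -/
noncomputable abbrev evalComplex (x : P) :
    CochainComplex (PosetRep k P) ℤ ⥤ CochainComplex (ModuleCat.{u} k) ℤ :=
  ((evaluation P (ModuleCat.{u} k)).obj x).mapHomologicalComplex _

variable {k}

lemma acyclic_evalComplex_iff (M : CochainComplex (PosetRep k P) ℤ) (x : P) :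
    ((evalComplex k x).obj M).Acyclic ↔ ∀ i, IsZero ((M.homology i).obj x) :=
  forall_congr' fun i => (HomologicalComplex.exactAt_iff_isZero_homology _ _).trans
    ((M.sc i).mapHomologyIso ((evaluation P (ModuleCat.{u} k)).obj x)).isZero_iff

lemma shortExact_evalComplex {S : ShortComplex (CochainComplex (PosetRep k P) ℤ)}
    (hS : S.ShortExact) (x : P) : (S.map (evalComplex k x)).ShortExact :=
  hS.map_of_exact (evalComplex k x)

lemma projective_module (V : ModuleCat.{u} k) : Projective V :=
  ModuleCat.projective_of_free (Module.Basis.ofVectorSpace k V)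

lemma injective_module (V : ModuleCat.{u} k) : Injective V where
  factors g f hf := by
    obtain ⟨r, hr⟩ := f.hom.exists_leftInverse_of_injective
      (LinearMap.ker_eq_bot.2 ((ModuleCat.mono_iff_injective f).1 hf))
    exact ⟨ModuleCat.ofHom r ≫ g, by
      apply ModuleCat.hom_ext
      apply LinearMap.ext
      intro v
      exact congrArg g.hom (LinearMap.congr_fun hr v)⟩

instance (x : P) : (evaluationLeftAdjoint (ModuleCat.{u} k) x).Additive :=
  (evaluationAdjunctionRight (ModuleCat.{u} k) x).left_adjoint_additive

instance (x : P) : (evaluationRightAdjoint (ModuleCat.{u} k) x).Additive :=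
  (evaluationAdjunctionLeft (ModuleCat.{u} k) x).right_adjoint_additive

lemma isZero_evaluationLeftAdjoint (x y : P) (h : ¬ x ≤ y) (V : ModuleCat.{u} k) :
    IsZero (((evaluationLeftAdjoint (ModuleCat.{u} k) x).obj V).obj y) := by
  rw [IsZero.iff_id_eq_zero]
  exact Sigma.hom_ext _ _ fun g => (h (leOfHom g)).elim

lemma isZero_evaluationRightAdjoint (x y : P) (h : ¬ y ≤ x) (V : ModuleCat.{u} k) :
    IsZero (((evaluationRightAdjoint (ModuleCat.{u} k) x).obj V).obj y) := by
  rw [IsZero.iff_id_eq_zero]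
  exact Pi.hom_ext _ _ fun g => (h (leOfHom g)).elim

lemma tr_evaluationLeftAdjoint_surjective {x y : P} (h : x ≤ y) (V : ModuleCat.{u} k) :
    Function.Surjective (tr ((evaluationLeftAdjoint (ModuleCat.{u} k) x).obj V) h) := by
  have : Epi (Sigma.desc fun g : x ⟶ x => Sigma.ι (fun _ : x ⟶ y => V) (g ≫ homOfLE h)) := by
    refine ⟨fun f g hfg => Sigma.hom_ext _ _ fun j => ?_⟩
    have := Sigma.ι (fun _ : x ⟶ x => V) (𝟙 x) ≫= hfg
    rw [Sigma.ι_desc_assoc, Sigma.ι_desc_assoc] at this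
    exact this
  exact (ModuleCat.epi_iff_surjective _).1 this

lemma tr_evaluationRightAdjoint_injective {x y : P} (h : y ≤ x) (V : ModuleCat.{u} k) :
    Function.Injective (tr ((evaluationRightAdjoint (ModuleCat.{u} k) x).obj V) h) := by
  have : Mono (Pi.lift fun g : x ⟶ x => Pi.π (fun _ : y ⟶ x => V) (homOfLE h ≫ g)) := by
    refine ⟨fun f g hfg => Pi.hom_ext _ _ fun j => ?_⟩
    have := hfg =≫ Pi.π (fun _ : x ⟶ x => V) (𝟙 x)
    rw [Category.assoc, Category.assoc, Pi.lift_π] at this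
    exact this
  exact (ModuleCat.mono_iff_injective _).1 this

instance (x : P) (V : ModuleCat.{u} k) :
    IsIso ((evaluationAdjunctionRight (ModuleCat.{u} k) x).unit.app V) := by
  rw [evaluationAdjunctionRight_unit_app]
  have : IsIso (Sigma.ι (fun _ : x ⟶ x => V) (𝟙 x)) := by
    refine ⟨Sigma.desc fun _ => 𝟙 V, Sigma.ι_desc _ _, Sigma.hom_ext _ _ fun j => ?_⟩
    rw [Sigma.ι_desc_assoc, Category.id_comp, Category.comp_id]
    exact congrArg (Sigma.ι (fun _ : x ⟶ x => V)) (Subsingleton.elim _ _)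
  exact this

instance (x : P) (V : ModuleCat.{u} k) :
    IsIso ((evaluationAdjunctionLeft (ModuleCat.{u} k) x).counit.app V) := by
  rw [evaluationAdjunctionLeft_counit_app]
  have : IsIso (Pi.π (fun _ : x ⟶ x => V) (𝟙 x)) := by
    refine ⟨Pi.lift fun _ => 𝟙 V, Pi.hom_ext _ _ fun j => ?_, Pi.lift_π _ _⟩
    rw [Category.assoc, Pi.lift_π, Category.id_comp, Category.comp_id]
    exact congrArg (Pi.π (fun _ : x ⟶ x => V)) (Subsingleton.elim _ _)
  exact this

/-- This representation is generated at `x`, so its top lives at `x` alone. Extending a resolution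
by it can therefore spoil minimality only at `x`. -/
lemma radical_evaluationLeftAdjoint {x y : P} (h : y ≠ x) (V : ModuleCat.{u} k) :
    radical ((evaluationLeftAdjoint (ModuleCat.{u} k) x).obj V) y = ⊤ := by
  by_cases hxy : x ≤ y
  · refine eq_top_iff.2 fun v _ => ?_
    obtain ⟨w, rfl⟩ := tr_evaluationLeftAdjoint_surjective hxy V v
    exact tr_mem_radical _ (lt_of_le_of_ne hxy h.symm) w
  · have := ModuleCat.subsingleton_of_isZero (isZero_evaluationLeftAdjoint x y hxy V)
    exact Subsingleton.elim _ _

lemma socle_evaluationRightAdjoint {x y : P} (h : y ≠ x) (V : ModuleCat.{u} k) :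
    socle ((evaluationRightAdjoint (ModuleCat.{u} k) x).obj V) y = ⊥ := by
  by_cases hxy : y ≤ x
  · refine eq_bot_iff.2 fun v hv => ?_
    apply tr_evaluationRightAdjoint_injective hxy V
    rw [mem_socle.1 hv x (lt_of_le_of_ne hxy h), map_zero]
  · have := ModuleCat.subsingleton_of_isZero (isZero_evaluationRightAdjoint x y hxy V)
    exact Subsingleton.elim _ _

/-- A complex with zero differentials, freely generated at `x`, that accounts for the homology of
`M` at `x`. -/
lemma exists_free_approximation (M : CochainComplex (PosetRep k P) ℤ) (x : P) :
    ∃ (D : CochainComplex (ModuleCat.{u} k) ℤ)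
      (f : ((evaluationLeftAdjoint (ModuleCat.{u} k) x).mapHomologicalComplex _).obj D ⟶ M),
      (∀ i, IsZero (M.homology i) → IsZero (D.X i)) ∧ (∀ i j, D.d i j = 0) ∧
      QuasiIso ((evalComplex k x).map f) := by
  obtain ⟨D, φ, hD, hd, hφ⟩ := exists_quasiIso_from_homology ((evalComplex k x).obj M)
    projective_module
  let adj := complexAdjunction (evaluationAdjunctionRight (ModuleCat.{u} k) x)
  have hu : IsIso (adj.unit.app D) :=
    have (i : ℤ) : IsIso ((adj.unit.app D).f i) := inferInstanceAs
      (IsIso ((evaluationAdjunctionRight (ModuleCat.{u} k) x).unit.app (D.X i)))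
    HomologicalComplex.Hom.isIso_of_components _
  refine ⟨D, (adj.homEquiv D M).symm φ, fun i hi => ?_, hd, ?_⟩
  · rw [hD]
    exact (((evaluation P (ModuleCat.{u} k)).obj x).map_isZero hi).of_iso
      ((M.sc i).mapHomologyIso ((evaluation P (ModuleCat.{u} k)).obj x))
  -- The adjoint of `φ`, evaluated at `x`, is `φ` up to the unit, which is invertible because `x ⟶
  -- x` has one element.
  · have h : adj.unit.app D ≫ (evalComplex k x).map ((adj.homEquiv D M).symm φ) = φ :=
      (adj.homEquiv_unit ..).symm.trans (Equiv.apply_symm_apply _ _)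
    have : QuasiIso (adj.unit.app D ≫ (evalComplex k x).map ((adj.homEquiv D M).symm φ)) :=
      h.symm ▸ hφ
    exact quasiIso_of_comp_left (adj.unit.app D) _

/-- A complex with zero differentials, cofreely generated at `x`, that accounts for the homology
of `M` at `x`. -/
lemma exists_cofree_approximation (M : CochainComplex (PosetRep k P) ℤ) (x : P) :
    ∃ (D : CochainComplex (ModuleCat.{u} k) ℤ)
      (f : M ⟶ ((evaluationRightAdjoint (ModuleCat.{u} k) x).mapHomologicalComplex _).obj D),
      (∀ i, IsZero (M.homology i) → IsZero (D.X i)) ∧ (∀ i j, D.d i j = 0) ∧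
      QuasiIso ((evalComplex k x).map f) := by
  obtain ⟨D, φ, hD, hd, hφ⟩ := exists_quasiIso_to_homology ((evalComplex k x).obj M)
    injective_module
  let adj := complexAdjunction (evaluationAdjunctionLeft (ModuleCat.{u} k) x)
  have hu : IsIso (adj.counit.app D) :=
    have (i : ℤ) : IsIso ((adj.counit.app D).f i) := inferInstanceAs
      (IsIso ((evaluationAdjunctionLeft (ModuleCat.{u} k) x).counit.app (D.X i)))
    HomologicalComplex.Hom.isIso_of_components _
  refine ⟨D, adj.homEquiv M D φ, fun i hi => ?_, hd, ?_⟩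
  · rw [hD]
    exact (((evaluation P (ModuleCat.{u} k)).obj x).map_isZero hi).of_iso
      ((M.sc i).mapHomologyIso ((evaluation P (ModuleCat.{u} k)).obj x))
  · have h : (evalComplex k x).map (adj.homEquiv M D φ) ≫ adj.counit.app D = φ :=
      (adj.homEquiv_counit ..).symm.trans (Equiv.symm_apply_apply _ _)
    have : QuasiIso ((evalComplex k x).map (adj.homEquiv M D φ) ≫ adj.counit.app D) :=
      h.symm ▸ hφ
    exact quasiIso_of_comp_right _ (adj.counit.app D)

end Evaluation

/-! ### Existence of minimal resolutions -/

section Existence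

variable {k : Type u} [Field k] {P : Type u} [PartialOrder P]

lemma isZero_of_isZero_obj {V : PosetRep k P} (h : ∀ x, IsZero (V.obj x)) : IsZero V := by
  rw [IsZero.iff_id_eq_zero]
  ext x : 2
  exact (h x).eq_of_src _ _

lemma quasiIso_of_isZero_homology {K L : CochainComplex (PosetRep k P) ℤ} (f : K ⟶ L)
    (hK : ∀ i, IsZero (K.homology i)) (hL : ∀ i, IsZero (L.homology i)) : QuasiIso f := by
  rw [quasiIso_iff]
  intro i
  rw [quasiIsoAt_iff_isIso_homologyMap]
  exact (hK i).isIso (hL i) _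

lemma exists_map_eq_of_shortExact {S : ShortComplex (CochainComplex (PosetRep k P) ℤ)}
    (hS : S.ShortExact) (i : ℤ) (y : P) (v : (S.X₂.X i).obj y) (hv : at' (S.g.f i) y v = 0) :
    ∃ u, at' (S.f.f i) y u = v := by
  have h := (hS.map_of_exact (HomologicalComplex.eval _ _ i)).map_of_exact
    ((evaluation P (ModuleCat.{u} k)).obj y)
  exact (ShortComplex.moduleCat_exact_iff _).1 h.exact v hv

lemma shortExact_f_injective {S : ShortComplex (CochainComplex (PosetRep k P) ℤ)}
    (hS : S.ShortExact) (i : ℤ) (y : P) : Function.Injective (at' (S.f.f i) y) :=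
  have := (hS.map_of_exact (HomologicalComplex.eval _ _ i)).mono_f
  have : Mono (S.f.f i) := this
  injective_of_mono _ y

lemma shortExact_g_surjective {S : ShortComplex (CochainComplex (PosetRep k P) ℤ)}
    (hS : S.ShortExact) (i : ℤ) (y : P) : Function.Surjective (at' (S.g.f i) y) :=
  have := (hS.map_of_exact (HomologicalComplex.eval _ _ i)).epi_g
  have : Epi (S.g.f i) := this
  surjective_of_epi _ y

lemma at_d_comm {K L : CochainComplex (PosetRep k P) ℤ} (f : K ⟶ L) (i j : ℤ) (y : P)
    (v : (K.X i).obj y) : at' (L.d i j) y (at' (f.f i) y v) = at' (f.f j) y (at' (K.d i j) y v) := by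
  rw [← at_comp, ← at_comp, f.comm]

lemma isZero_X₂_obj {S : ShortComplex (CochainComplex (PosetRep k P) ℤ)}
    (hS : S.ShortExact) (i : ℤ) (y : P) (h₁ : IsZero ((S.X₁.X i).obj y))
    (h₃ : IsZero ((S.X₃.X i).obj y)) : IsZero ((S.X₂.X i).obj y) := by
  have h := (hS.map_of_exact (HomologicalComplex.eval _ _ i)).map_of_exact
    ((evaluation P (ModuleCat.{u} k)).obj y)
  exact h.exact.isZero_X₂ (h₁.eq_of_src _ _) (h₃.eq_of_tgt _ _)

/-- Minimal projective resolutions of complexes with homology supported on a finite upper set, by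
induction on its size: the homology at a minimal element `x` is split off by a free approximation,
and the resolution of its cofiber is extended by it. -/
lemma exists_minimal_projective_of_upperSet [Finite P] (n : ℤ) (m : ℕ) (T : Finset P)
    (hT : ∀ x ∈ T, ∀ y, x ≤ y → y ∈ T) (hm : T.card = m) (M : CochainComplex (PosetRep k P) ℤ)
    (hn : ∀ i, n < i → IsZero (M.homology i)) (hM : HomologySupportedOn (T : Set P) M) :
    ∃ (R : CochainComplex (PosetRep k P) ℤ) (π : R ⟶ M), QuasiIso π ∧
      (∀ i, n < i → IsZero (R.X i)) ∧ (∀ i, Projective (R.X i)) ∧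
      (∀ (i j : ℤ) (y : P), LinearMap.range (at' (R.d i j) y) ≤ radical (R.X j) y) ∧
      ∀ y ∉ T, ∀ i, IsZero ((R.X i).obj y) := by
  classical
  induction m generalizing T M with
  | zero =>
    obtain rfl := Finset.card_eq_zero.1 hm
    obtain ⟨Z, hZ⟩ := HasZeroObject.zero (C := CochainComplex (PosetRep k P) ℤ)
    have h0 (i : ℤ) : IsZero (Z.X i) := (HomologicalComplex.eval _ _ i).map_isZero hZ
    refine ⟨Z, 0, quasiIso_of_isZero_homology _
      (fun i => (HomologicalComplex.homologyFunctor _ _ i).map_isZero hZ)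
      (fun i => isZero_of_isZero_obj fun x => hM i x (by simp)), fun i _ => h0 i,
      fun i => (h0 i).projective, fun i j y => ?_, fun y _ i =>
        ((evaluation P (ModuleCat.{u} k)).obj y).map_isZero (h0 i)⟩
    have : Subsingleton ((Z.X j).obj y) := ModuleCat.subsingleton_of_isZero
      (((evaluation P (ModuleCat.{u} k)).obj y).map_isZero (h0 j))
    rintro v -
    rw [Subsingleton.elim v 0]
    exact zero_mem _
  | succ m ih =>
    obtain ⟨x, hx⟩ := T.exists_minimal (Finset.card_pos.1 (hm ▸ m.succ_pos))
    obtain ⟨D, f, hD, hd, hf⟩ := exists_free_approximation M x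
    let E := ((evaluationLeftAdjoint (ModuleCat.{u} k) x).mapHomologicalComplex
      (ComplexShape.up ℤ)).obj D
    have hE0 (i : ℤ) (h : IsZero (M.homology i)) : IsZero (E.X i) :=
      (evaluationLeftAdjoint (ModuleCat.{u} k) x).map_isZero (hD i h)
    have hEy (y : P) (hy : ¬ x ≤ y) (i : ℤ) : IsZero ((E.X i).obj y) :=
      isZero_evaluationLeftAdjoint x y hy _
    have hEd (i j : ℤ) : E.d i j = 0 :=
      (congrArg (evaluationLeftAdjoint (ModuleCat.{u} k) x).map (hd i j)).trans
        (Functor.map_zero _ _ _)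
    -- With `M` replaced by `N`, the cofiber of `f` becomes an honest cokernel.
    obtain ⟨N, e, p, he, hp, hep⟩ := exists_mono_quasiIso f
    have hS : (ShortComplex.mk e (cokernel.π e) (cokernel.condition e)).ShortExact :=
      { exact := ShortComplex.exact_cokernel e
        mono_f := he
        epi_g := inferInstanceAs (Epi (cokernel.π e)) }
    -- The long exact sequence puts this homology between that of `N` in degree `i` and that of `E`
    -- in degree `i + 1`; both degrees exceed `n`.
    have hC : ∀ i, n < i → IsZero ((cokernel e).homology i) := fun i hi => by
      refine (hS.homology_exact₃ i (i + 1) rfl).isZero_X₂ ?_ ?_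
      · exact ((hn i hi).of_iso (isoOfQuasiIsoAt p i)).eq_of_src _ _
      · refine IsZero.eq_of_tgt ?_ _ _
        exact (HomologicalComplex.ExactAt.of_isZero (hE0 _ (hn _ (by omega)))).isZero_homology
    have hSy (y : P) := shortExact_evalComplex hS y
    -- At `x` the map `f` is a quasi-isomorphism. At `y ∉ T` both `M` and `E` are acyclic, the
    -- latter since `T` is an upper set and so `x ≤ y` fails.
    have hCT : HomologySupportedOn ((T.erase x : Finset P) : Set P) (cokernel e) := by
      intro i y hy
      revert i
      rw [← acyclic_evalComplex_iff]
      refine (hSy y).acyclic_X₃ ?_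
      change QuasiIso ((evalComplex k y).map e)
      have hc : (evalComplex k y).map e ≫ (evalComplex k y).map p = (evalComplex k y).map f := by
        rw [← Functor.map_comp, hep]
      suffices h : QuasiIso ((evalComplex k y).map f) by
        have : QuasiIso ((evalComplex k y).map e ≫ (evalComplex k y).map p) := hc.symm ▸ h
        exact quasiIso_of_comp_right _ ((evalComplex k y).map p)
      by_cases hyx : y = x
      · exact hyx ▸ hf
      · have hyT : y ∉ T := fun h => hy (by simp [hyx, h])
        have h1 : ¬ x ≤ y := fun h => hyT (hT x hx.1 y h)
        have h2 := (acyclic_evalComplex_iff M y).2 fun i => hM i y hyT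
        rw [quasiIso_iff]
        intro i
        rw [quasiIsoAt_iff_exactAt _ _ (HomologicalComplex.ExactAt.of_isZero (hEy y h1 i))]
        exact h2 i
    obtain ⟨R', ρ, hρ, hR'n, hR'p, hR'm, hR'T⟩ := ih (T.erase x) (fun z hz y hzy => by
        have hzT := Finset.mem_of_mem_erase hz
        refine Finset.mem_erase.2 ⟨fun h => ?_, hT z hzT y hzy⟩
        subst h
        exact Finset.ne_of_mem_erase hz (le_antisymm hzy (hx.2 hzT hzy)))
      (by rw [Finset.card_erase_of_mem hx.1, hm]; rfl) (cokernel e) hC hCT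
    -- `R` is an extension of `R'` by `E`, termwise split because the terms of `R'` are projective.
    obtain ⟨R, f', g, w, π, hR, hπ⟩ := exists_pullback_shortExact hS ρ
    refine ⟨R, π ≫ p, inferInstance, fun i hi => ?_, fun i => ?_, fun i j y => ?_,
      fun y hy i => ?_⟩
    · exact isZero_of_isZero_obj fun y => isZero_X₂_obj hR i y
        (((evaluation P (ModuleCat.{u} k)).obj y).map_isZero (hE0 i (hn i hi)))
        (((evaluation P (ModuleCat.{u} k)).obj y).map_isZero (hR'n i hi))
    · have h1 := hR.map_of_exact (HomologicalComplex.eval _ _ i)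
      have h2 : Projective (E.X i) := by
        have := projective_module (D.X i)
        exact (evaluationAdjunctionRight (ModuleCat.{u} k) x).map_projective _ this
      have h3 : Projective (R'.X i) := hR'p i
      have h4 : Projective ((ShortComplex.mk f' g w).map (HomologicalComplex.eval _ _ i)).X₃ := h3
      exact Projective.of_iso h1.splittingOfProjective.isoBinaryBiproduct.symm
        (inferInstanceAs (Projective (E.X i ⊞ R'.X i)))
    · rintro _ ⟨r, rfl⟩
      by_cases hyx : y = x
      · subst hyx
        -- The resolution `R'` vanishes at the removed element, so there `R` is `E`, whose
        -- differential is zero. This is why the induction also carries the vanishing outside `T`.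
        have := ModuleCat.subsingleton_of_isZero (hR'T y (by simp) i)
        obtain ⟨ε, rfl⟩ := exists_map_eq_of_shortExact hR i y r (Subsingleton.elim _ _)
        have h1 : at' (R.d i j) y (at' (f'.f i) y ε) = 0 := by
          rw [at_d_comm]
          have : at' (E.d i j) y = 0 := by rw [hEd]; rfl
          exact (congrArg (at' (f'.f j) y) (LinearMap.congr_fun this ε)).trans (map_zero _)
        refine Eq.mpr (congrArg (· ∈ radical (R.X j) y) h1) (zero_mem _)
      · have h1 : at' (g.f j) y (at' (R.d i j) y r) ∈ radical (R'.X j) y := by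
          rw [← at_d_comm]
          exact hR'm i j y ⟨_, rfl⟩
        -- Away from `x`, the image of `d r` in `R'` lifts to the radical of `R`, and the error lies
        -- in `E`, which equals its radical there.
        obtain ⟨s, hs, hs'⟩ := radical_le_map (g.f j) (shortExact_g_surjective hR j) y h1
        obtain ⟨ε, hε⟩ := exists_map_eq_of_shortExact hR j y (at' (R.d i j) y r - s) (by
          change at' (g.f j) y _ = 0
          rw [map_sub, hs', sub_self])
        have hE : radical (E.X j) y = ⊤ := radical_evaluationLeftAdjoint hyx _
        have h2 : ε ∈ radical (E.X j) y := hE ▸ Submodule.mem_top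
        have h3 : at' (R.d i j) y r - s ∈ radical (R.X j) y :=
          hε ▸ radical_le_comap (f'.f j) y h2
        simpa using add_mem h3 hs
    · exact isZero_X₂_obj hR i y (hEy y (fun h => hy (hT x hx.1 y h)) i)
        (hR'T y (fun h => hy (Finset.mem_of_mem_erase h)) i)

/-- Minimal injective resolutions of complexes with homology supported on a finite lower set, by
induction on its size. -/
lemma exists_minimal_injective_of_lowerSet [Finite P] (n : ℤ) (m : ℕ) (T : Finset P)
    (hT : ∀ x ∈ T, ∀ y, y ≤ x → y ∈ T) (hm : T.card = m) (M : CochainComplex (PosetRep k P) ℤ)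
    (hn : ∀ i, i < n → IsZero (M.homology i)) (hM : HomologySupportedOn (T : Set P) M) :
    ∃ (R : CochainComplex (PosetRep k P) ℤ) (ι : M ⟶ R), QuasiIso ι ∧
      (∀ i, i < n → IsZero (R.X i)) ∧ (∀ i, Injective (R.X i)) ∧
      (∀ (i j : ℤ) (y : P), socle (R.X i) y ≤ LinearMap.ker (at' (R.d i j) y)) ∧
      ∀ y ∉ T, ∀ i, IsZero ((R.X i).obj y) := by
  classical
  induction m generalizing T M with
  | zero =>
    obtain rfl := Finset.card_eq_zero.1 hm
    obtain ⟨Z, hZ⟩ := HasZeroObject.zero (C := CochainComplex (PosetRep k P) ℤ)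
    have h0 (i : ℤ) : IsZero (Z.X i) := (HomologicalComplex.eval _ _ i).map_isZero hZ
    refine ⟨Z, 0, quasiIso_of_isZero_homology _
      (fun i => isZero_of_isZero_obj fun x => hM i x (by simp))
      (fun i => (HomologicalComplex.homologyFunctor _ _ i).map_isZero hZ), fun i _ => h0 i,
      fun i => (h0 i).injective, fun i j y => ?_, fun y _ i =>
        ((evaluation P (ModuleCat.{u} k)).obj y).map_isZero (h0 i)⟩
    have : Subsingleton ((Z.X i).obj y) := ModuleCat.subsingleton_of_isZero
      (((evaluation P (ModuleCat.{u} k)).obj y).map_isZero (h0 i))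
    intro v _
    rw [Subsingleton.elim v 0]
    exact zero_mem _
  | succ m ih =>
    obtain ⟨x, hx⟩ := T.exists_maximal (Finset.card_pos.1 (hm ▸ m.succ_pos))
    obtain ⟨D, f, hD, hd, hf⟩ := exists_cofree_approximation M x
    let E := ((evaluationRightAdjoint (ModuleCat.{u} k) x).mapHomologicalComplex
      (ComplexShape.up ℤ)).obj D
    have hE0 (i : ℤ) (h : IsZero (M.homology i)) : IsZero (E.X i) :=
      (evaluationRightAdjoint (ModuleCat.{u} k) x).map_isZero (hD i h)
    have hEy (y : P) (hy : ¬ y ≤ x) (i : ℤ) : IsZero ((E.X i).obj y) :=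
      isZero_evaluationRightAdjoint x y hy _
    have hEd (i j : ℤ) : E.d i j = 0 :=
      (congrArg (evaluationRightAdjoint (ModuleCat.{u} k) x).map (hd i j)).trans
        (Functor.map_zero _ _ _)
    -- Dually, the fiber of `f` becomes an honest kernel. A resolution of it, which vanishes at the
    -- maximal element `x`, is then extended by `E`.
    obtain ⟨N, q, e, hq, he, hqe⟩ := exists_quasiIso_epi f
    have hS : (ShortComplex.mk (kernel.ι e) e (kernel.condition e)).ShortExact :=
      { exact := ShortComplex.exact_kernel e
        mono_f := inferInstanceAs (Mono (kernel.ι e))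
        epi_g := he }
    have hC : ∀ i, i < n → IsZero ((kernel e).homology i) := fun i hi => by
      refine (hS.homology_exact₁ (i - 1) i (sub_add_cancel i 1)).isZero_X₂ ?_ ?_
      · refine IsZero.eq_of_src ?_ _ _
        exact (HomologicalComplex.ExactAt.of_isZero (hE0 _ (hn _ (by omega)))).isZero_homology
      · exact ((hn i hi).of_iso (isoOfQuasiIsoAt q i).symm).eq_of_tgt _ _
    have hSy (y : P) := shortExact_evalComplex hS y
    have hCT : HomologySupportedOn ((T.erase x : Finset P) : Set P) (kernel e) := by
      intro i y hy
      revert i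
      rw [← acyclic_evalComplex_iff]
      refine (hSy y).acyclic_X₁ ?_
      change QuasiIso ((evalComplex k y).map e)
      have hc : (evalComplex k y).map q ≫ (evalComplex k y).map e = (evalComplex k y).map f := by
        rw [← Functor.map_comp, hqe]
      suffices h : QuasiIso ((evalComplex k y).map f) by
        have : QuasiIso ((evalComplex k y).map q ≫ (evalComplex k y).map e) := hc.symm ▸ h
        exact quasiIso_of_comp_left ((evalComplex k y).map q) _
      by_cases hyx : y = x
      · exact hyx ▸ hf
      · have hyT : y ∉ T := fun h => hy (by simp [hyx, h])
        have h1 : ¬ y ≤ x := fun h => hyT (hT x hx.1 y h)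
        have h2 := (acyclic_evalComplex_iff M y).2 fun i => hM i y hyT
        rw [quasiIso_iff]
        intro i
        rw [quasiIsoAt_iff_exactAt' _ _ (HomologicalComplex.ExactAt.of_isZero (hEy y h1 i))]
        exact h2 i
    obtain ⟨R', ρ, hρ, hR'n, hR'p, hR'm, hR'T⟩ := ih (T.erase x) (fun z hz y hzy => by
        have hzT := Finset.mem_of_mem_erase hz
        refine Finset.mem_erase.2 ⟨fun h => ?_, hT z hzT y hzy⟩
        subst h
        exact Finset.ne_of_mem_erase hz (le_antisymm (hx.2 hzT hzy) hzy))
      (by rw [Finset.card_erase_of_mem hx.1, hm]; rfl) (kernel e) hC hCT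
    obtain ⟨R, f', g, w, ι, hR, hι⟩ := exists_pushout_shortExact hS ρ
    refine ⟨R, q ≫ ι, inferInstance, fun i hi => ?_, fun i => ?_, fun i j y => ?_,
      fun y hy i => ?_⟩
    · exact isZero_of_isZero_obj fun y => isZero_X₂_obj hR i y
        (((evaluation P (ModuleCat.{u} k)).obj y).map_isZero (hR'n i hi))
        (((evaluation P (ModuleCat.{u} k)).obj y).map_isZero (hE0 i (hn i hi)))
    · have h1 := hR.map_of_exact (HomologicalComplex.eval _ _ i)
      have h2 : Injective (E.X i) := by
        have := injective_module (D.X i)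
        exact (evaluationAdjunctionLeft (ModuleCat.{u} k) x).map_injective _ this
      have h3 : Injective (R'.X i) := hR'p i
      have h4 : Injective ((ShortComplex.mk f' g w).map (HomologicalComplex.eval _ _ i)).X₁ := h3
      exact Injective.of_iso h1.splittingOfInjective.isoBinaryBiproduct.symm
        (inferInstanceAs (Injective (R'.X i ⊞ E.X i)))
    · intro r hr
      by_cases hyx : y = x
      · subst hyx
        have : Subsingleton ((R'.X j).obj y) :=
          ModuleCat.subsingleton_of_isZero (hR'T y (by simp) j)
        have h1 : at' (g.f j) y (at' (R.d i j) y r) = 0 := by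
          rw [← at_d_comm]
          have : at' (E.d i j) y = 0 := by rw [hEd]; rfl
          exact LinearMap.congr_fun this _
        obtain ⟨u, hu⟩ := exists_map_eq_of_shortExact hR j y (at' (R.d i j) y r) h1
        rw [LinearMap.mem_ker, ← hu]
        exact (congrArg (at' (f'.f j) y) (Subsingleton.elim u 0)).trans (map_zero _)
      -- Away from `x` the complex `E` has no socle, so a socle vector of `R` comes from a socle
      -- vector of `R'`, where minimality is known.
      · have hE : socle (E.X i) y = ⊥ := socle_evaluationRightAdjoint hyx _
        have h1 : at' (g.f i) y r ∈ socle (E.X i) y := mem_socle.2 fun z hz => by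
          refine (at_tr (g.f i) hz.le r).symm.trans ?_
          rw [mem_socle.1 hr z hz, map_zero]
        rw [hE] at h1
        obtain ⟨u, rfl⟩ := exists_map_eq_of_shortExact hR i y r h1
        have h2 : u ∈ socle (R'.X i) y := mem_socle.2 fun z hz => by
          apply shortExact_f_injective hR i z
          change at' (f'.f i) z _ = at' (f'.f i) z _
          rw [at_tr, map_zero]
          exact mem_socle.1 hr z hz
        rw [LinearMap.mem_ker]
        refine (at_d_comm f' i j y u).trans ?_
        rw [LinearMap.mem_ker.1 (hR'm i j y h2), map_zero]
    · exact isZero_X₂_obj hR i y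
        (hR'T y (fun h => hy (Finset.mem_of_mem_erase h)) i)
        (hEy y (fun h => hy (hT x hx.1 y h)) i)

end Existence

/-! ### Assembly: existence, transfer along quasi-isomorphisms, and induced resolutions. -/

section Main

variable {k : Type u} [Field k] {P : Type u} [PartialOrder P]

/-- Every complex with homology bounded above has a minimal projective resolution. -/
theorem exists_isMinimalProjectiveResolution [Finite P] (M : CochainComplex (PosetRep k P) ℤ)
    (hM : BoundedHomology M) :
    ∃ (R : CochainComplex (PosetRep k P) ℤ) (π : R ⟶ M), IsMinimalProjectiveResolution π := by
  have := Fintype.ofFinite P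
  obtain ⟨_, n, hn⟩ := hM
  obtain ⟨R, π, h1, h2, h3, h4, -⟩ := exists_minimal_projective_of_upperSet n _ Finset.univ
    (fun _ _ _ _ => Finset.mem_univ _) rfl M (fun i hi => hn i (.inr hi))
    (fun _ x hx => (hx (Finset.mem_coe.2 (Finset.mem_univ x))).elim)
  exact ⟨R, π, h1, ⟨n, h2⟩, h3, h4⟩

/-- Every complex with homology bounded below has a minimal injective resolution. -/
theorem exists_isMinimalInjectiveResolution [Finite P] (M : CochainComplex (PosetRep k P) ℤ)
    (hM : BoundedHomology M) :
    ∃ (R : CochainComplex (PosetRep k P) ℤ) (ι : M ⟶ R), IsMinimalInjectiveResolution ι := by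
  have := Fintype.ofFinite P
  obtain ⟨n, _, hn⟩ := hM
  obtain ⟨R, ι, h1, h2, h3, h4, -⟩ := exists_minimal_injective_of_lowerSet n _ Finset.univ
    (fun _ _ _ _ => Finset.mem_univ _) rfl M (fun i hi => hn i (.inl hi))
    (fun _ x hx => (hx (Finset.mem_coe.2 (Finset.mem_univ x))).elim)
  exact ⟨R, ι, h1, ⟨n, h2⟩, h3, h4⟩

lemma HomologySupportedOn.of_quasiIso {S : Set P} {K L : CochainComplex (PosetRep k P) ℤ}
    (h : HomologySupportedOn S K) (f : K ⟶ L) [QuasiIso f] : HomologySupportedOn S L :=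
  fun i x hx => (h i x hx).of_iso (homology_obj_iso f i x).some.symm

lemma HomologySupportedOn.of_quasiIso' {S : Set P} {K L : CochainComplex (PosetRep k P) ℤ}
    (h : HomologySupportedOn S L) (f : K ⟶ L) [QuasiIso f] : HomologySupportedOn S K :=
  fun i x hx => (h i x hx).of_iso (homology_obj_iso f i x).some

lemma bijective_of_subsingleton {V W : ModuleCat.{u} k} [Subsingleton V] [Subsingleton W]
    (f : V →ₗ[k] W) : Function.Bijective f :=
  ⟨fun _ _ _ => Subsingleton.elim _ _, fun _ => ⟨0, Subsingleton.elim _ _⟩⟩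

/-- The homology vanishes off `[a, ∞)`, at `b` and above `b`, so the transitions from `b` are maps
between zero spaces. -/
lemma isIso_counit_homology (a b : P) [IsClamped a b] {M : CochainComplex (PosetRep k P) ℤ}
    (hM : HomologySupportedOn (Set.Ico a b) M) (i : ℤ) :
    IsIso ((inductionAdjunction k (Set.Icc a b)).counit.app (M.homology i)) :=
  isIso_counit_app a b _
    (fun x hx => ModuleCat.subsingleton_of_isZero (hM i x fun h => hx h.1))
    fun x hx =>
      have := ModuleCat.subsingleton_of_isZero (hM i b fun h => h.2.false)
      have := ModuleCat.subsingleton_of_isZero (hM i x fun h => h.2.not_ge hx)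
      bijective_of_subsingleton _

lemma isIso_unit_homology (a b : P) [IsClamped a b] {M : CochainComplex (PosetRep k P) ℤ}
    (hM : HomologySupportedOn (Set.Ioc a b) M) (i : ℤ) :
    IsIso ((coinductionAdjunction k (Set.Icc a b)).unit.app (M.homology i)) :=
  isIso_unit_app a b _
    (fun x hx => ModuleCat.subsingleton_of_isZero (hM i x fun h => hx h.2))
    fun x hx =>
      have := ModuleCat.subsingleton_of_isZero (hM i a fun h => h.1.false)
      have := ModuleCat.subsingleton_of_isZero (hM i x fun h => h.1.not_ge hx)
      bijective_of_subsingleton _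

lemma IsFiniteDimensional.of_quasiIso {K L : CochainComplex (PosetRep k P) ℤ} (f : K ⟶ L)
    [QuasiIso f] (h : ∀ i, IsFiniteDimensional (K.homology i)) (i : ℤ) :
    IsFiniteDimensional (L.homology i) := fun x =>
  have := h i x
  Module.Finite.equiv (homology_obj_iso f i x).some.toLinearEquiv

lemma IsFiniteDimensional.of_quasiIso' {K L : CochainComplex (PosetRep k P) ℤ} (f : K ⟶ L)
    [QuasiIso f] (h : ∀ i, IsFiniteDimensional (L.homology i)) (i : ℤ) :
    IsFiniteDimensional (K.homology i) := fun x =>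
  have := h i x
  Module.Finite.equiv (homology_obj_iso f i x).some.symm.toLinearEquiv

/-- A minimal complex of projectives with homology supported on `[a, b)` is induced. -/
theorem exists_iso_inductionComplex [Finite P] (a b : P) [IsClamped a b]
    {R : CochainComplex (PosetRep k P) ℤ} (hbd : ∃ n : ℤ, ∀ i : ℤ, n < i → IsZero (R.X i))
    [∀ i, Projective (R.X i)]
    (hmin : ∀ (i j : ℤ) (y : P), LinearMap.range (at' (R.d i j) y) ≤ radical (R.X j) y)
    (hR : HomologySupportedOn (Set.Ico a b) R) :
    ∃ R' : CochainComplex (PosetRep k (Set.Icc a b)) ℤ,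
      (∃ n : ℤ, ∀ i : ℤ, n < i → IsZero (R'.X i)) ∧ (∀ i, Projective (R'.X i)) ∧
      Nonempty (R ≅ (inductionComplex k (Set.Icc a b)).obj R') := by
  have h (i : ℤ) := isIso_counit_of_minimal a b hmin hR i
  obtain ⟨n, hn⟩ := hbd
  have h' : IsIso ((complexAdjunction (inductionAdjunction k (Set.Icc a b))).counit.app R) :=
    have (i : ℤ) : IsIso (((complexAdjunction
      (inductionAdjunction k (Set.Icc a b))).counit.app R).f i) := h i
    HomologicalComplex.Hom.isIso_of_components _
  exact ⟨(restrictionComplex k (Set.Icc a b)).obj R,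
    ⟨n, fun i hi => (restriction k (Set.Icc a b)).map_isZero (hn i hi)⟩,
    fun i => projective_restriction (R.X i),
    ⟨(asIso ((complexAdjunction (inductionAdjunction k (Set.Icc a b))).counit.app R)).symm⟩⟩

/-- A minimal complex of injectives with homology supported on `(a, b]` is coinduced. -/
theorem exists_iso_coinductionComplex [Finite P] (a b : P) [IsClamped a b]
    {R : CochainComplex (PosetRep k P) ℤ} (hbd : ∃ n : ℤ, ∀ i : ℤ, i < n → IsZero (R.X i))
    [∀ i, Injective (R.X i)]
    (hmin : ∀ (i j : ℤ) (y : P), socle (R.X i) y ≤ LinearMap.ker (at' (R.d i j) y))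
    (hR : HomologySupportedOn (Set.Ioc a b) R) :
    ∃ R' : CochainComplex (PosetRep k (Set.Icc a b)) ℤ,
      (∃ n : ℤ, ∀ i : ℤ, i < n → IsZero (R'.X i)) ∧ (∀ i, Injective (R'.X i)) ∧
      Nonempty (R ≅ (coinductionComplex k (Set.Icc a b)).obj R') := by
  have h (i : ℤ) := isIso_unit_of_minimal a b hmin hR i
  obtain ⟨n, hn⟩ := hbd
  have h' : IsIso ((complexAdjunction (coinductionAdjunction k (Set.Icc a b))).unit.app R) :=
    have (i : ℤ) : IsIso (((complexAdjunction
      (coinductionAdjunction k (Set.Icc a b))).unit.app R).f i) := h i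
    HomologicalComplex.Hom.isIso_of_components _
  exact ⟨(restrictionComplex k (Set.Icc a b)).obj R,
    ⟨n, fun i hi => (restriction k (Set.Icc a b)).map_isZero (hn i hi)⟩,
    fun i => injective_restriction (R.X i),
    ⟨asIso ((complexAdjunction (coinductionAdjunction k (Set.Icc a b))).unit.app R)⟩⟩

end Main

end PosetRep

theorem mainTheorem6 {k : Type u} [Field k] {P : Type u} [PartialOrder P] [Finite P]
    (a b : P) [PosetRep.IsClamped a b]
    [HasDerivedCategory.{w₁} (PosetRep k P)]
    [HasDerivedCategory.{w₂} (PosetRep k (Set.Icc a b))] :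
    -- complexes `M` with homology supported on `[a, b)`
    (∀ M : CochainComplex (PosetRep k P) ℤ, PosetRep.BoundedHomology M →
      PosetRep.HomologySupportedOn (Set.Ico a b) M →
      (∃ (R : CochainComplex (PosetRep k P) ℤ) (π : R ⟶ M),
        PosetRep.IsMinimalProjectiveResolution π) ∧
      (∀ (R : CochainComplex (PosetRep k P) ℤ) (π : R ⟶ M),
        PosetRep.IsMinimalProjectiveResolution π →
        (∀ i, PosetRep.IsDirectSumFrom (PosetRep.proj k) (Set.Icc a b) (R.X i)) ∧
        ((∀ i, PosetRep.IsFiniteDimensional (M.homology i)) →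
          ∀ i, PosetRep.IsFiniteDimensional (R.X i)) ∧
        ∃ R' : CochainComplex (PosetRep k (Set.Icc a b)) ℤ,
          (∃ n : ℤ, ∀ i : ℤ, n < i → IsZero (R'.X i)) ∧ (∀ i, Projective (R'.X i)) ∧
          Nonempty (R ≅ (PosetRep.inductionComplex k (Set.Icc a b)).obj R')) ∧
      IsIso ((PosetRep.derivedInductionAdjunction k (Set.Icc a b)).counit.app
        (DerivedCategory.Q.obj M)) ∧
      ∃ L : DerivedCategory (PosetRep k (Set.Icc a b)),
        DerivedCategory.TStructure.t.bounded L ∧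
        Nonempty ((PosetRep.derivedInduction k (Set.Icc a b)).obj L ≅
          DerivedCategory.Q.obj M)) ∧
    -- complexes `N` with homology supported on `(a, b]`
    (∀ N : CochainComplex (PosetRep k P) ℤ, PosetRep.BoundedHomology N →
      PosetRep.HomologySupportedOn (Set.Ioc a b) N →
      (∃ (R : CochainComplex (PosetRep k P) ℤ) (ι : N ⟶ R),
        PosetRep.IsMinimalInjectiveResolution ι) ∧
      (∀ (R : CochainComplex (PosetRep k P) ℤ) (ι : N ⟶ R),
        PosetRep.IsMinimalInjectiveResolution ι →
        (∀ i, PosetRep.IsDirectSumFrom (PosetRep.inj k) (Set.Icc a b) (R.X i)) ∧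
        ((∀ i, PosetRep.IsFiniteDimensional (N.homology i)) →
          ∀ i, PosetRep.IsFiniteDimensional (R.X i)) ∧
        ∃ R' : CochainComplex (PosetRep k (Set.Icc a b)) ℤ,
          (∃ n : ℤ, ∀ i : ℤ, i < n → IsZero (R'.X i)) ∧ (∀ i, Injective (R'.X i)) ∧
          Nonempty (R ≅ (PosetRep.coinductionComplex k (Set.Icc a b)).obj R')) ∧
      IsIso ((PosetRep.derivedCoinductionAdjunction k (Set.Icc a b)).unit.app
        (DerivedCategory.Q.obj N)) ∧
      ∃ L : DerivedCategory (PosetRep k (Set.Icc a b)),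
        DerivedCategory.TStructure.t.bounded L ∧
        Nonempty (DerivedCategory.Q.obj N ≅
          (PosetRep.derivedCoinduction k (Set.Icc a b)).obj L)) ∧
    -- complexes over `[a, b]` with homology supported on `(a, b)`
    Nonempty
      ((PosetRep.boundedSupportedOn (k := k) {x : Set.Icc a b | (x : P) ∈ Set.Ioo a b}).ι ⋙
          PosetRep.derivedInduction k (Set.Icc a b) ≅
        (PosetRep.boundedSupportedOn (k := k) {x : Set.Icc a b | (x : P) ∈ Set.Ioo a b}).ι ⋙
          PosetRep.derivedCoinduction k (Set.Icc a b)) := by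
  refine ⟨fun M hM hsupp => ⟨PosetRep.exists_isMinimalProjectiveResolution M hM,
      fun R π hπ => ?_, ?_⟩, fun N hN hsupp => ⟨PosetRep.exists_isMinimalInjectiveResolution N hN,
      fun R ι hι => ?_, ?_⟩, PosetRep.nonempty_derivedInduction_iso_derivedCoinduction a b⟩
  · have := hπ.quasiIso
    have := hπ.projective
    have hR := hsupp.of_quasiIso' π
    exact ⟨PosetRep.isDirectSumFrom_proj_of_minimal a b hπ.minimal hR,
      fun hfin => PosetRep.isFiniteDimensional_of_minimal_projective hπ.boundedAbove hπ.minimal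
        (PosetRep.IsFiniteDimensional.of_quasiIso' π hfin),
      PosetRep.exists_iso_inductionComplex a b hπ.boundedAbove hπ.minimal hR⟩
  · have h := PosetRep.isIso_derivedInductionAdjunction_counit (Set.Icc a b) M
      (PosetRep.isIso_counit_homology a b hsupp)
    -- The witness `L` is the restriction of `M`, and the counit itself is the isomorphism.
    exact ⟨h, _, PosetRep.bounded_derivedRestriction (Set.Icc a b) hM,
      ⟨asIso ((PosetRep.derivedInductionAdjunction k (Set.Icc a b)).counit.app
        (DerivedCategory.Q.obj M))⟩⟩
  · have := hι.quasiIso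
    have := hι.injective
    have hR := hsupp.of_quasiIso ι
    exact ⟨PosetRep.isDirectSumFrom_inj_of_minimal a b hι.minimal hR,
      fun hfin => PosetRep.isFiniteDimensional_of_minimal_injective hι.boundedBelow hι.minimal
        (PosetRep.IsFiniteDimensional.of_quasiIso ι hfin),
      PosetRep.exists_iso_coinductionComplex a b hι.boundedBelow hι.minimal hR⟩
  · have h := PosetRep.isIso_derivedCoinductionAdjunction_unit (Set.Icc a b) N
      (PosetRep.isIso_unit_homology a b hsupp)
    exact ⟨h, _, PosetRep.bounded_derivedRestriction (Set.Icc a b) hN,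
      ⟨asIso ((PosetRep.derivedCoinductionAdjunction k (Set.Icc a b)).unit.app
        (DerivedCategory.Q.obj N))⟩⟩
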